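/- Let $\mathcal A$ be a unital $C^*$-algebra and $\mathcal E$ a Hilbert $\mathcal A$-module with $\mathcal A$-valued inner product $\langle\cdot|\cdot\rangle$, conjugate linear in the first and linear in the second variable. (The module is written as a left module, $\langle x|a\,y\rangle=a\langle x|y\rangle$; this is the same as a right Hilbert module over the opposite algebra $\mathcal A^{op}$, and $\mathcal A$ is arbitrary.) Let $\mathcal L_{\mathcal A}(\mathcal E)$ be the algebra of adjointable operators, $\mathcal F_{\mathcal A}(\mathcal E)$ the span of the operators $\pi_{x,y}\colon z\mapsto\langle y|z\rangle x$ (the $\mathcal A$-finite operators) and $\mathcal K_{\mathcal A}(\mathcal E)$ its norm closure. An unbounded $\mathcal A$-linear operator $D$ on $\mathcal E$ is called $\mathcal A$-elliptic if $D$ and $D^*$ are densely defined, $1+D^*D$ has dense range, and $(1+D^*D)^{-1}\in\mathcal K_{\mathcal A}(\mathcal E)$. The spectrum of $D$ is the set of $z\in\mathbb C$ for which $D-z$ has no inverse in $\mathcal L_{\mathcal A}(\mathcal E)$; an isolated eigenvalue is an eigenvalue that is an isolated point of the spectrum. For a positive linear functional $\tau$ on $\mathcal A$ that is a normalized faithful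 trace, let $H_\tau$ (respectively $h_\tau$) be the completion of $\mathcal E$ with respect to $\tau(\langle x|y\rangle)$ (respectively of $\mathcal A$ with respect to $\tau(a^*b)$), let $\pi_\tau(T)$ be the bounded extension of $T\in\mathcal L_{\mathcal A}(\mathcal E)$ to $H_\tau$, and let $D_\tau$ be the closure of $D$ as an operator on $H_\tau$. Let $\operatorname{tr}_\tau$ be the trace with $\operatorname{tr}_\tau\pi_{x,y}=\tau(\langle y|x\rangle)$ on $\mathcal F_{\mathcal A}(\mathcal E)$, extended to positive $T\in\mathcal L_{\mathcal A}(\mathcal E)$ by $$\operatorname{tr}_\tau T=\sup\Big\{\sum_i\tau(\langle x_i|x_i\rangle)\;:\;x_1,\dots,x_n\in\mathcal E,\ \sum_i\pi_{x_i,x_i}\le T\Big\};$$ the $\operatorname{tr}_\tau$-trace class operators are the linear combinations of positive operators of finite trace. **Theorem.** Let $D$ be a self-adjoint $\mathcal A$-elliptic operator on $\mathcal E$. 1. If $\lambda$ is an isolated eigenvalue of $D$, then its eigenspace $E_\lambda=\ker(D-\lambda)$ is a closed submodule of $\mathcal E$ that is (algebraically) finitely generated and projective over $\mathcal A$, the orthogonal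 projection $P_\lambda$ of $\mathcal E$ onto $E_\lambda$ exists, and $P_\lambda$ is $\mathcal A$-finite. 2. Let $\tau$ be a normalized faithful trace on $\mathcal A$. If $e^{-tD^2}$ is $\operatorname{tr}_\tau$-trace class for some $t>0$, then for every isolated eigenvalue $\lambda$ of $D$ the projection $P_\lambda$ is $\operatorname{tr}_\tau$-trace class, i.e. $E_\lambda$ has finite $\tau$-dimension $\operatorname{tr}_\tau P_\lambda<\infty$; this number equals $\sum_i\tau(\langle y_i|x_i\rangle)$ whenever $P_\lambda=\sum_{i=1}^n\pi_{x_i,y_i}$. 3. Let $\tau$ be a normalized faithful trace on $\mathcal A$, let $\mathcal A$ be infinite dimensional, and suppose that $h_\tau$ has an orthonormal basis consisting of unitary elements of $\mathcal A$. Then every isolated eigenvalue $\lambda$ of $D$ has infinite Hilbert multiplicity: the closure of $E_\lambda$ in $H_\tau$ is infinite dimensional, and the Hilbert space trace of $\pi_\tau(P_\lambda)$ is $\infty$. In particular $D_\tau$ has essential spectrum only: its spectrum contains no isolated eigenvalue of finite multiplicity, i.e. $\operatorname{spec}_{\mathrm{ess}}D_\tau=\operatorname{spec}D_\tau$. -/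

import Mathlib

open scoped ComplexOrder InnerProductSpace ENNReal Topology
open Filter

namespace NCBloch

/-! ### Operators on a Hilbert `A`-module

A Hilbert `A`-module is Mathlib's `CStarModule A E`: `E` is a left `A`-module with an `A`-valued
inner product that is conjugate-linear in the first and linear in the second variable,
`⟪x, a • y⟫ = a * ⟪x, y⟫`. This is the same thing as a right Hilbert module over the opposite
algebra. -/

section Module

variable (A : Type*) {E : Type*} [CStarAlgebra A] [PartialOrder A] [StarOrderedRing A]
  [NormedAddCommGroup E] [NormedSpace ℂ E] [Module A E] [CStarModule A E]

variable {A} in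
theorem norm_smul_le' (a : A) (x : E) : ‖a • x‖ ≤ ‖a‖ * ‖x‖ := by
  refine le_of_sq_le_sq ?_ (by positivity)
  rw [CStarModule.norm_sq_eq A, mul_pow, CStarModule.norm_sq_eq A (x := x)]
  simp only [CStarModule.inner_op_smul_right, CStarModule.inner_op_smul_left]
  calc ‖a * (⟪x, x⟫_A * star a)‖ ≤ ‖a‖ * (‖⟪x, x⟫_A‖ * ‖star a‖) :=
        (norm_mul_le _ _).trans (by gcongr; exact norm_mul_le _ _)
    _ = ‖a‖ ^ 2 * ‖⟪x, x⟫_A‖ := by rw [norm_star]; ring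

/-- The operator `π_{x,y} : z ↦ ⟪y, z⟫ • x`. -/
noncomputable def rankOne [IsScalarTower ℂ A E] (x y : E) : E →L[ℂ] E :=
  LinearMap.mkContinuous
    { toFun := fun z => ⟪y, z⟫_A • x
      map_add' := fun z w => by rw [CStarModule.inner_add_right, add_smul]
      map_smul' := fun c z => by
        rw [CStarModule.inner_smul_right_complex, smul_assoc, RingHom.id_apply] }
    (‖y‖ * ‖x‖) (fun z => by
      calc ‖⟪y, z⟫_A • x‖ ≤ ‖⟪y, z⟫_A‖ * ‖x‖ := norm_smul_le' _ _
        _ ≤ (‖y‖ * ‖z‖) * ‖x‖ := by gcongr; exact CStarModule.norm_inner_le E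
        _ = ‖y‖ * ‖x‖ * ‖z‖ := by ring)

/-- The `A`-finite operators `F_A(E)`. -/
noncomputable def finiteOperators (E : Type*) [NormedAddCommGroup E] [NormedSpace ℂ E]
    [Module A E] [CStarModule A E] [IsScalarTower ℂ A E] : Submodule ℂ (E →L[ℂ] E) :=
  Submodule.span ℂ {T | ∃ x y : E, T = rankOne A x y}

/-- The `A`-compact operators `K_A(E)`, the norm closure of the `A`-finite ones. -/
noncomputable def compactOperators (E : Type*) [NormedAddCommGroup E] [NormedSpace ℂ E]
    [Module A E] [CStarModule A E] [IsScalarTower ℂ A E] : Submodule ℂ (E →L[ℂ] E) :=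
  (finiteOperators A E).topologicalClosure

/-- `T` belongs to `L_A(E)`: it has an adjoint. -/
def IsAdjointable (T : E →L[ℂ] E) : Prop :=
  ∃ T' : E →L[ℂ] E, ∀ x y : E, ⟪x, T y⟫_A = ⟪T' x, y⟫_A

/-- `T` is a positive element of the C⋆-algebra `L_A(E)`. -/
def IsPositiveOperator (T : E →L[ℂ] E) : Prop :=
  IsAdjointable A T ∧ ∀ x : E, 0 ≤ ⟪x, T x⟫_A

/-- `P` is the orthogonal projection of `E` onto the submodule `N`. -/
structure IsProjectionOnto (P : E →L[ℂ] E) (N : Submodule A E) : Prop where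
  idem : ∀ x, P (P x) = P x
  symm : ∀ x y : E, ⟪x, P y⟫_A = ⟪P x, y⟫_A
  range_eq : Set.range P = (N : Set E)

/-! ### Unbounded operators -/

variable {A}

/-- The adjoint `D*`, as a graph: `(y, z)` belongs to it iff `⟪y, D x⟫ = ⟪z, x⟫` for all `x` in
the domain of `D`. -/
def adjointGraph (D : E →ₗ.[A] E) : Submodule A (E × E) where
  carrier := {p | ∀ x : D.domain, ⟪p.1, D x⟫_A = ⟪p.2, (x : E)⟫_A}
  add_mem' := fun {p q} hp hq x => by
    simp only [Prod.fst_add, Prod.snd_add, CStarModule.inner_add_left, hp x, hq x]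
  zero_mem' := fun x => by simp
  smul_mem' := fun a p hp x => by
    simp only [Prod.smul_fst, Prod.smul_snd, CStarModule.inner_op_smul_left, hp x]

/-- `D = D*`, equality of domains included. -/
def IsSelfAdjointOp (D : E →ₗ.[A] E) : Prop :=
  Dense (D.domain : Set E) ∧ D.graph = adjointGraph D

/-- `x` lies in the domain of `D*D` and `D*D x = w`. -/
def AdjointCompSelf (D : E →ₗ.[A] E) (x w : E) : Prop :=
  ∃ y, (x, y) ∈ D.graph ∧ (y, w) ∈ adjointGraph D

/-- `x` lies in the domain of `D²` and `D² x = w`. -/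
def Square (D : E →ₗ.[A] E) (x w : E) : Prop :=
  ∃ y, (x, y) ∈ D.graph ∧ (y, w) ∈ D.graph

/-- `A`-elliptic operators. In the last field, `S` is the inverse of `1 + D*D`. -/
structure IsElliptic [IsScalarTower ℂ A E] (D : E →ₗ.[A] E) : Prop where
  dense_domain : Dense (D.domain : Set E)
  dense_adjoint_domain : Dense {y : E | ∃ z, (y, z) ∈ adjointGraph D}
  dense_range : Dense {v : E | ∃ x w, AdjointCompSelf D x w ∧ x + w = v}
  compact_resolvent : ∃ S ∈ compactOperators A E,
    ∀ v x : E, S v = x ↔ ∃ w, AdjointCompSelf D x w ∧ x + w = v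

/-- `R` is the everywhere defined inverse of `T - z`, where `T` is the operator with graph `G`. -/
def IsResolventAt {X : Type*} [AddCommGroup X] [Module ℂ X] (G : Set (X × X)) (z : ℂ)
    (R : X → X) : Prop :=
  ∀ v x, R v = x ↔ ∃ y, (x, y) ∈ G ∧ y - z • x = v

/-- The spectrum of an unbounded operator on a Hilbert module: the `z` such that `D - z` has no
inverse in `L_A(E)`. -/
def moduleSpectrum (D : E →ₗ.[A] E) : Set ℂ :=
  {z | ¬ ∃ R : E →L[ℂ] E, IsAdjointable A R ∧ IsResolventAt (D.graph : Set (E × E)) z R}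

/-- The eigenspace `ker (D - l)`, an `A`-submodule of `E`. -/
def eigenspace [IsScalarTower ℂ A E] (D : E →ₗ.[A] E) (l : ℝ) : Submodule A E where
  carrier := {x | (x, (l : ℂ) • x) ∈ D.graph}
  add_mem' := fun {x y} hx hy => by
    simpa only [Set.mem_ofPred_eq, Prod.mk_add_mk, ← smul_add] using D.graph.add_mem hx hy
  zero_mem' := by
    change ((0 : E), (l : ℂ) • (0 : E)) ∈ D.graph
    rw [smul_zero]
    exact D.graph.zero_mem
  smul_mem' := fun a x hx => by
    have h := D.graph.smul_mem a hx
    rw [Prod.smul_mk, ← smul_comm (l : ℂ) a x] at h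
    exact h

/-- `z` is isolated in `S`. -/
def IsIsolatedIn (S : Set ℂ) (z : ℂ) : Prop :=
  ∃ ε > 0, ∀ w ∈ S, dist w z < ε → w = z

/-- `l` is an eigenvalue of `D` and an isolated point of its spectrum. -/
def IsIsolatedEigenvalue [IsScalarTower ℂ A E] (D : E →ₗ.[A] E) (l : ℝ) : Prop :=
  eigenspace D l ≠ ⊥ ∧ IsIsolatedIn (moduleSpectrum D) (l : ℂ)

/-- `T t = e^{-t D²}`, `t ≥ 0`: the strongly continuous semigroup with generator `-D²`. -/
structure IsHeatSemigroup (D : E →ₗ.[A] E) (T : ℝ → E →L[ℂ] E) : Prop where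
  zero : ∀ x, T 0 x = x
  add : ∀ s t, 0 ≤ s → 0 ≤ t → ∀ x, T (s + t) x = T s (T t x)
  continuous : ∀ x, ContinuousOn (fun t => T t x) (Set.Ici 0)
  generator : ∀ x w,
    Tendsto (fun h : ℝ => ((h⁻¹ : ℝ) : ℂ) • (T h x - x)) (𝓝[>] 0) (𝓝 (-w)) ↔ Square D x w

/-- `U = e^{-t D²}`. -/
def IsHeatOperator (D : E →ₗ.[A] E) (t : ℝ) (U : E →L[ℂ] E) : Prop :=
  ∃ T, IsHeatSemigroup D T ∧ T t = U

end Module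

/-! ### The trace on `A` and the induced trace on `L_A(E)` -/

section Trace

variable {A E : Type*} [CStarAlgebra A] [PartialOrder A] [StarOrderedRing A]
  [NormedAddCommGroup E] [NormedSpace ℂ E] [Module A E] [CStarModule A E]

/-- `τ` is a normalized faithful trace. -/
structure IsFaithfulTrace (τ : A →ₚ[ℂ] ℂ) : Prop where
  normalized : τ 1 = 1
  faithful : ∀ a, τ (star a * a) = 0 → a = 0
  trace : ∀ a b, τ (a * b) = τ (b * a)

/-- The trace `tr_τ` on positive operators, determined by `tr_τ π_{x,x} = τ ⟪x, x⟫`: the supremum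
of `∑ i, τ ⟪x i, x i⟫` over all finite families with `∑ i, π_{x i, x i} ≤ T`. -/
noncomputable def trTau [IsScalarTower ℂ A E] (τ : A →ₚ[ℂ] ℂ) (T : E →L[ℂ] E) : ℝ≥0∞ :=
  ⨆ (n : ℕ) (x : Fin n → E)
    (_ : IsPositiveOperator A (T - ∑ i, rankOne A (x i) (x i))),
      ENNReal.ofReal (∑ i, (τ ⟪x i, x i⟫_A).re)

/-- The trace class ideal of `tr_τ` in `L_A(E)`: the span of the positive operators of finite
trace. -/
noncomputable def traceClass [IsScalarTower ℂ A E] (τ : A →ₚ[ℂ] ℂ) :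
    Submodule ℂ (E →L[ℂ] E) :=
  Submodule.span ℂ {T | IsPositiveOperator A T ∧ trTau τ T ≠ ⊤}

/-- The GNS space `h_τ` of `A` has an orthonormal basis of unitaries of `A`. -/
def HasUnitaryBasis (τ : A →ₚ[ℂ] ℂ) : Prop :=
  ∃ s : Set A, s ⊆ (unitary A : Set A) ∧
    ∃ b : HilbertBasis s ℂ τ.GNS, ∀ u : s, b u = ((τ.toPreGNS (u : A) : τ.PreGNS) : τ.GNS)

/-! ### The GNS space of a Hilbert module -/

set_option linter.unusedVariables false in
/-- `E` with the semi-inner product `⟨x|y⟩_τ = τ ⟪x, y⟫` (type synonym). -/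
@[nolint unusedArguments]
def PreGNS (τ : A →ₚ[ℂ] ℂ) (E : Type*) := E

instance (τ : A →ₚ[ℂ] ℂ) : AddCommGroup (PreGNS τ E) := inferInstanceAs (AddCommGroup E)
instance (τ : A →ₚ[ℂ] ℂ) : Module ℂ (PreGNS τ E) := inferInstanceAs (Module ℂ E)

/-- The identity map from `E` to its synonym. -/
def toPreGNS (τ : A →ₚ[ℂ] ℂ) (E : Type*) [NormedAddCommGroup E] [NormedSpace ℂ E] :
    E ≃ₗ[ℂ] PreGNS τ E := LinearEquiv.refl ℂ E

noncomputable abbrev preGNSCore (τ : A →ₚ[ℂ] ℂ) (E : Type*) [NormedAddCommGroup E]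
    [NormedSpace ℂ E] [Module A E] [CStarModule A E] :
    PreInnerProductSpace.Core ℂ (PreGNS τ E) where
  inner x y := τ ⟪(toPreGNS τ E).symm x, (toPreGNS τ E).symm y⟫_A
  conj_inner_symm x y := by
    rw [← Complex.star_def, ← map_star τ, CStarModule.star_inner]
  re_inner_nonneg x :=
    (RCLike.nonneg_iff.mp (τ.map_nonneg CStarModule.inner_self_nonneg)).1
  add_left x y z := by rw [map_add, CStarModule.inner_add_left, map_add]
  smul_left x y c := by
    rw [map_smul, CStarModule.inner_smul_left_complex, map_smul, smul_eq_mul, Complex.star_def]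

noncomputable instance (τ : A →ₚ[ℂ] ℂ) : SeminormedAddCommGroup (PreGNS τ E) :=
  InnerProductSpace.Core.toSeminormedAddCommGroup (c := preGNSCore τ E)
noncomputable instance (τ : A →ₚ[ℂ] ℂ) : InnerProductSpace ℂ (PreGNS τ E) :=
  InnerProductSpace.ofCore (preGNSCore τ E)

/-- The Hilbert space `H_τ`, the completion of `E` for `⟨x|y⟩_τ = τ ⟪x, y⟫`. -/
abbrev GNS (τ : A →ₚ[ℂ] ℂ) (E : Type*) [NormedAddCommGroup E] [NormedSpace ℂ E] [Module A E]
    [CStarModule A E] := UniformSpace.Completion (PreGNS τ E)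

/-- The canonical map `E → H_τ`. -/
noncomputable def toGNS (τ : A →ₚ[ℂ] ℂ) (E : Type*) [NormedAddCommGroup E] [NormedSpace ℂ E]
    [Module A E] [CStarModule A E] : E →ₗ[ℂ] GNS τ E :=
  (UniformSpace.Completion.toComplL (𝕜 := ℂ) (E := PreGNS τ E)).toLinearMap ∘ₗ
    (toPreGNS τ E).toLinearMap

/-- The closure in `H_τ` of a submodule of `E`. -/
noncomputable def closureInGNS [IsScalarTower ℂ A E] (τ : A →ₚ[ℂ] ℂ) (N : Submodule A E) :
    Submodule ℂ (GNS τ E) :=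
  ((N.restrictScalars ℂ).map (toGNS τ E)).topologicalClosure

/-- `Q = π_τ(T)`: the bounded operator on `H_τ` that extends `T`. -/
def IsGNSExtension (τ : A →ₚ[ℂ] ℂ) (T : E →L[ℂ] E) (Q : GNS τ E →L[ℂ] GNS τ E) : Prop :=
  ∀ x, Q (toGNS τ E x) = toGNS τ E (T x)

/-- The operator defined by `D` on `H_τ`: its graph is the closure of the graph of `D`. -/
noncomputable def hilbertOperator [IsScalarTower ℂ A E] (τ : A →ₚ[ℂ] ℂ) (D : E →ₗ.[A] E) :
    GNS τ E →ₗ.[ℂ] GNS τ E :=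
  (((D.graph.restrictScalars ℂ).map
    ((toGNS τ E).prodMap (toGNS τ E))).topologicalClosure).toLinearPMap

end Trace

/-! ### Unbounded operators on Hilbert spaces -/

section HilbertSpace

variable {H : Type*} [NormedAddCommGroup H] [InnerProductSpace ℂ H]

/-- The trace of a positive operator, computed in a Hilbert basis. -/
noncomputable def hilbertTrace {ι : Type*} (b : HilbertBasis ι ℂ H) (Q : H →L[ℂ] H) : ℝ≥0∞ :=
  ∑' i, ENNReal.ofReal (RCLike.re ⟪b i, Q (b i)⟫_ℂ)

def hilbertSpectrum (T : H →ₗ.[ℂ] H) : Set ℂ :=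
  {z | ¬ ∃ R : H →L[ℂ] H, IsResolventAt (T.graph : Set (H × H)) z R}

def hilbertEigenspace (T : H →ₗ.[ℂ] H) (z : ℂ) : Submodule ℂ H where
  carrier := {x | (x, z • x) ∈ T.graph}
  add_mem' := fun {x y} hx hy => by
    simpa only [Set.mem_ofPred_eq, Prod.mk_add_mk, ← smul_add] using T.graph.add_mem hx hy
  zero_mem' := by
    change ((0 : H), z • (0 : H)) ∈ T.graph
    rw [smul_zero]
    exact T.graph.zero_mem
  smul_mem' := fun a x hx => by
    have h := T.graph.smul_mem a hx
    rw [Prod.smul_mk, ← smul_comm z a x] at h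
    exact h

/-- The discrete spectrum of a self-adjoint operator: the isolated points of the spectrum that are
eigenvalues of finite multiplicity. -/
def discreteSpectrum (T : H →ₗ.[ℂ] H) : Set ℂ :=
  {z ∈ hilbertSpectrum T | IsIsolatedIn (hilbertSpectrum T) z ∧ hilbertEigenspace T z ≠ ⊥ ∧
    FiniteDimensional ℂ (hilbertEigenspace T z)}

/-- The essential spectrum of a self-adjoint operator: the complement of the discrete spectrum. -/
def essentialSpectrum (T : H →ₗ.[ℂ] H) : Set ℂ :=
  hilbertSpectrum T \ discreteSpectrum T

end HilbertSpace

end NCBloch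

open NCBloch

/-!
The eigenprojection `P` at an isolated eigenvalue `l` comes from the functional calculus in the
C⋆-algebra `L_A(E)` of adjointable operators. For a real `μ ≠ l` close to `l` the resolvent
`(D - μ)⁻¹` is a self-adjoint element of `L_A(E)`, the point `(l - μ)⁻¹` is isolated in its
spectrum, and the spectral projection at that point has range `ker (D - l)`
(`exists_isolated_spectral_projection`, `exists_eigenprojection`). On this range `(1 + D*D)⁻¹` is
the scalar `(1 + l²)⁻¹`, so `P` is `A`-compact by ellipticity. An `A`-compact projection is
`A`-finite: if `G = F P` with `F` finite is close to `P`, then `U = 1 - (P - G)` is invertible and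
`P = U⁻¹ G` (`mem_finiteOperators_of_idempotent`). A representation `P = ∑ i, π_{x i, y i}` exhibits
`ker (D - l)` as a direct summand of `A ^ n`.

Being `A`-finite, `P` has finite trace. It has a frame, `P = ∑ j, π_{u j, u j}`
(`IsProjectionOnto.exists_frame`), and the trace property of `τ` gives
`∑ i, τ ⟪x i, x i⟫ ≤ ∑ j, τ ⟪u j, u j⟫` whenever `∑ i, π_{x i, x i} ≤ P`, so that the supremum
defining `tr_τ P` is attained at the frame. Any other representation of `P` gives the same number,
because `∑ i, π_{x i, y i} = 0` implies `∑ i, τ ⟪y i, x i⟫ = 0` (`sum_trace_eq_zero`). Indeed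
`∑ i, τ ⟪y i, F (x i)⟫ = 0` for `A`-finite `F` by cyclicity, and `F` can be chosen with `F (x i)`
arbitrarily close to `x i`.

For the infinite multiplicity, unitaries of `A` act isometrically on `H_τ`, since `τ` is a trace. If
the unitaries `u` run through an orthonormal basis of `h_τ`, then `⟨y | u x⟩_τ = τ (⟪y, x⟫ u)` is a
coefficient of the element `⟪x, y⟫` of `h_τ`, so these isometries tend weakly to zero. On a
finite-dimensional invariant subspace they would tend strongly to zero, which isometries do only
on the zero space (`eq_bot_of_unitary_invariant`). This applies to the closure of `ker (D - l)` and,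
as `D_τ` commutes with the unitaries, to every eigenspace of `D_τ`.
-/

open scoped ComplexOrder InnerProductSpace ENNReal Topology
open Filter

set_option linter.unusedSectionVars false

namespace NCBloch

/-! ### The C⋆-algebra of adjointable operators -/

section Adjointable

variable {A E : Type*} [CStarAlgebra A] [PartialOrder A] [StarOrderedRing A]
  [NormedAddCommGroup E] [NormedSpace ℂ E] [Module A E] [CStarModule A E]

variable (A) in
theorem eq_of_inner_eq {x y : E} (h : ∀ z : E, ⟪z, x⟫_A = ⟪z, y⟫_A) : x = y := by
  rw [← sub_eq_zero, ← CStarModule.inner_self (A := A), CStarModule.inner_sub_right, h, sub_self]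

/-- Two operators that are adjoint to each other have the same norm; one inequality suffices, by
symmetry. -/
theorem norm_adjoint_le {T T' : E →L[ℂ] E} (h : ∀ x y : E, ⟪x, T y⟫_A = ⟪T' x, y⟫_A) :
    ‖T'‖ ≤ ‖T‖ := by
  refine T'.opNorm_le_bound (norm_nonneg _) fun x => ?_
  have h1 : ‖T' x‖ * ‖T' x‖ ≤ ‖T‖ * ‖x‖ * ‖T' x‖ := by
    rw [← sq, CStarModule.norm_sq_eq A, ← h]
    calc ‖⟪x, T (T' x)⟫_A‖ ≤ ‖x‖ * ‖T (T' x)‖ := CStarModule.norm_inner_le E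
      _ ≤ ‖x‖ * (‖T‖ * ‖T' x‖) := by gcongr; exact T.le_opNorm _
      _ = ‖T‖ * ‖x‖ * ‖T' x‖ := by ring
  rcases (norm_nonneg (T' x)).eq_or_lt with h0 | h0
  · rw [← h0]; positivity
  · exact le_of_mul_le_mul_right h1 h0

theorem inner_adjoint_symm {T T' : E →L[ℂ] E} (h : ∀ x y : E, ⟪x, T y⟫_A = ⟪T' x, y⟫_A) (x y : E) :
    ⟪x, T' y⟫_A = ⟪T x, y⟫_A := by
  rw [← CStarModule.star_inner, ← h, CStarModule.star_inner]

variable (A E) in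
/-- The algebra `L_A(E)` of adjointable operators. -/
def adjointableAlgebra : Subalgebra ℂ (E →L[ℂ] E) where
  carrier := {T | IsAdjointable A T}
  mul_mem' := by
    rintro S T ⟨S', hS⟩ ⟨T', hT⟩
    exact ⟨T' * S', fun x y => by
      rw [mul_apply_eq_comp, mul_apply_eq_comp, hS, hT]⟩
  add_mem' := by
    rintro S T ⟨S', hS⟩ ⟨T', hT⟩
    exact ⟨S' + T', fun x y => by simp [hS, hT]⟩
  algebraMap_mem' c := ⟨algebraMap ℂ _ (star c), fun x y => by
    simp [Algebra.algebraMap_eq_smul_one]⟩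

namespace adjointableAlgebra

/-- The adjoint of an adjointable operator; it is unique, see `NCBloch.eq_of_inner_eq`. -/
noncomputable instance : Star (adjointableAlgebra A E) where
  star T := ⟨T.2.choose, T, fun x y => inner_adjoint_symm T.2.choose_spec x y⟩

theorem inner_right (T : adjointableAlgebra A E) (x y : E) :
    ⟪x, (T : E →L[ℂ] E) y⟫_A = ⟪(star T : adjointableAlgebra A E).1 x, y⟫_A :=
  T.2.choose_spec x y

theorem inner_left (T : adjointableAlgebra A E) (x y : E) :
    ⟪(T : E →L[ℂ] E) x, y⟫_A = ⟪x, (star T : adjointableAlgebra A E).1 y⟫_A :=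
  (inner_adjoint_symm T.2.choose_spec x y).symm

theorem star_eq_of {T T' : adjointableAlgebra A E}
    (h : ∀ x y : E, ⟪x, T.1 y⟫_A = ⟪T'.1 x, y⟫_A) : star T = T' := by
  ext y
  refine eq_of_inner_eq A fun z => ?_
  rw [← inner_left, inner_adjoint_symm h]

theorem isSelfAdjoint_of {T : adjointableAlgebra A E}
    (h : ∀ x y : E, ⟪x, T.1 y⟫_A = ⟪T.1 x, y⟫_A) : IsSelfAdjoint T :=
  star_eq_of h

theorem inner_comm_of_isSelfAdjoint {T : adjointableAlgebra A E} (hT : IsSelfAdjoint T) (x y : E) :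
    ⟪T.1 x, y⟫_A = ⟪x, T.1 y⟫_A := by
  rw [inner_right, hT.star_eq]

noncomputable instance : StarRing (adjointableAlgebra A E) where
  star_involutive T := star_eq_of fun x y => (inner_left T x y).symm
  star_mul S T := star_eq_of fun x y => by
    simp only [MulMemClass.coe_mul, mul_apply_eq_comp, inner_right]
  star_add S T := star_eq_of fun x y => by simp [inner_right]

instance : StarModule ℂ (adjointableAlgebra A E) where
  star_smul c T := star_eq_of fun x y => by simp [inner_right]

instance : CStarRing (adjointableAlgebra A E) where
  norm_mul_self_le T := by
    have key : ‖(T : E →L[ℂ] E)‖ ≤ √‖star T * T‖ := by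
      refine ContinuousLinearMap.opNorm_le_bound _ (Real.sqrt_nonneg _) fun x => ?_
      refine Real.le_sqrt_of_sq_le ?_ |>.trans_eq (Real.sqrt_mul_self (by positivity))
      have h1 : ‖T.1 x‖ ^ 2 ≤ ‖x‖ * (‖star T * T‖ * ‖x‖) := by
        rw [CStarModule.norm_sq_eq A, inner_left]
        refine (CStarModule.norm_inner_le E).trans ?_
        gcongr
        exact (star T * T).1.le_opNorm x
      calc ‖T.1 x‖ ^ 2 ≤ ‖x‖ * (‖star T * T‖ * ‖x‖) := h1
        _ = (√‖star T * T‖ * √‖star T * T‖) * (‖x‖ * ‖x‖) := by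
          rw [Real.mul_self_sqrt (norm_nonneg (star T * T))]; ring
        _ = _ := by ring
    calc ‖T‖ * ‖T‖ ≤ √‖star T * T‖ * √‖star T * T‖ := by gcongr <;> exact key
      _ = ‖star T * T‖ := Real.mul_self_sqrt (norm_nonneg _)

theorem isClosed [CompleteSpace E] : IsClosed (adjointableAlgebra A E : Set (E →L[ℂ] E)) := by
  refine isClosed_of_closure_subset fun T hT => ?_
  obtain ⟨u, hu, hlim⟩ := mem_closure_iff_seq_limit.1 hT
  choose u' hu' using hu
  have hc : CauchySeq u' := by
    rw [Metric.cauchySeq_iff']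
    intro ε hε
    obtain ⟨N, hN⟩ := Metric.cauchySeq_iff'.1 hlim.cauchySeq ε hε
    refine ⟨N, fun n hn => lt_of_le_of_lt ?_ (hN n hn)⟩
    rw [dist_eq_norm, dist_eq_norm]
    refine norm_adjoint_le (A := A) fun x y => ?_
    simp [hu']
  obtain ⟨T', hT'⟩ := cauchySeq_tendsto_of_complete hc
  have happ : ∀ {v : ℕ → E →L[ℂ] E} {V : E →L[ℂ] E}, Tendsto v atTop (𝓝 V) → ∀ x,
      Tendsto (fun n => v n x) atTop (𝓝 (V x)) := fun h x =>
    ((ContinuousLinearMap.apply ℂ E x).continuous.tendsto _).comp h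
  refine ⟨T', fun x y => ?_⟩
  have h1 : Tendsto (fun n => ⟪x, u n y⟫_A) atTop (𝓝 ⟪x, T y⟫_A) :=
    (CStarModule.continuous_inner.tendsto (x, T y)).comp
      (tendsto_const_nhds.prodMk_nhds (happ hlim y))
  have h2 : Tendsto (fun n => ⟪u' n x, y⟫_A) atTop (𝓝 ⟪T' x, y⟫_A) :=
    (CStarModule.continuous_inner.tendsto (T' x, y)).comp
      ((happ hT' x).prodMk_nhds tendsto_const_nhds)
  refine tendsto_nhds_unique h1 (h2.congr fun n => (hu' n x y).symm)

noncomputable instance [CompleteSpace E] : CStarAlgebra (adjointableAlgebra A E) where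
  toCompleteSpace := (isClosed (A := A) (E := E)).completeSpace_coe

/-- Adjointable operators are `A`-linear. -/
theorem map_smul (T : adjointableAlgebra A E) (a : A) (x : E) : T.1 (a • x) = a • T.1 x :=
  eq_of_inner_eq A fun z => by simp [inner_right]

end adjointableAlgebra

/-! ### The ideal of `A`-finite operators -/

variable [IsScalarTower ℂ A E]

theorem rankOne_apply (x y z : E) : rankOne A x y z = ⟪y, z⟫_A • x := rfl

theorem rankOne_neg_left (x y : E) : rankOne A (-x) y = -rankOne A x y := by
  ext z; simp [rankOne_apply]

theorem rankOne_smul_left (c : ℂ) (x y : E) :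
    rankOne A (c • x) y = c • rankOne A x y := by
  ext z; simp only [rankOne_apply, smul_apply, smul_comm c]

theorem inner_rankOne (u v x y : E) : ⟪u, rankOne A x y v⟫_A = ⟪y, v⟫_A * ⟪u, x⟫_A := by
  simp [rankOne_apply]

theorem inner_rankOne_comm (u v x y : E) : ⟪u, rankOne A x y v⟫_A = ⟪rankOne A y x u, v⟫_A := by
  simp [rankOne_apply]

theorem rankOne_mem_adjointableAlgebra (x y : E) : rankOne A x y ∈ adjointableAlgebra A E :=
  ⟨rankOne A y x, fun u v => inner_rankOne_comm u v x y⟩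

theorem finiteOperators_le :
    finiteOperators A E ≤ Subalgebra.toSubmodule (adjointableAlgebra A E) :=
  Submodule.span_le.2 <| by
    rintro _ ⟨x, y, rfl⟩
    exact rankOne_mem_adjointableAlgebra x y

theorem adjointable_mul_rankOne (T : adjointableAlgebra A E) (x y : E) :
    T.1 * rankOne A x y = rankOne A (T.1 x) y := by
  ext z; simp [rankOne_apply, adjointableAlgebra.map_smul]

theorem rankOne_mul_adjointable (T : adjointableAlgebra A E) (x y : E) :
    rankOne A x y * T.1 = rankOne A x ((star T : adjointableAlgebra A E).1 y) := by
  ext z; simp [rankOne_apply, adjointableAlgebra.inner_right]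

theorem mul_mem_finiteOperators_left (T : adjointableAlgebra A E) {F : E →L[ℂ] E}
    (hF : F ∈ finiteOperators A E) : T.1 * F ∈ finiteOperators A E := by
  induction hF using Submodule.span_induction with
  | mem F h =>
    obtain ⟨x, y, rfl⟩ := h
    rw [adjointable_mul_rankOne]
    exact Submodule.subset_span ⟨_, _, rfl⟩
  | zero => rw [mul_zero]; exact zero_mem _
  | add F G _ _ hF hG => rw [mul_add]; exact add_mem hF hG
  | smul c F _ hF => rw [mul_smul_comm]; exact Submodule.smul_mem _ _ hF

theorem mul_mem_finiteOperators_right (T : adjointableAlgebra A E) {F : E →L[ℂ] E}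
    (hF : F ∈ finiteOperators A E) : F * T.1 ∈ finiteOperators A E := by
  induction hF using Submodule.span_induction with
  | mem F h =>
    obtain ⟨x, y, rfl⟩ := h
    rw [rankOne_mul_adjointable]
    exact Submodule.subset_span ⟨_, _, rfl⟩
  | zero => rw [zero_mul]; exact zero_mem _
  | add F G _ _ hF hG => rw [add_mul]; exact add_mem hF hG
  | smul c F _ hF => rw [smul_mul_assoc]; exact Submodule.smul_mem _ _ hF

/-- An `A`-finite operator is a finite sum of operators `π_{x,y}`: scalars are absorbed into `x`. -/
theorem exists_sum_rankOne {F : E →L[ℂ] E} (hF : F ∈ finiteOperators A E) :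
    ∃ (n : ℕ) (x y : Fin n → E), F = ∑ i, rankOne A (x i) (y i) := by
  induction hF using Submodule.span_induction with
  | mem F h =>
    obtain ⟨x, y, rfl⟩ := h
    exact ⟨1, fun _ => x, fun _ => y, by simp⟩
  | zero => exact ⟨0, fun _ => 0, fun _ => 0, by simp⟩
  | add F G _ _ hF hG =>
    obtain ⟨n, x, y, rfl⟩ := hF
    obtain ⟨m, x', y', rfl⟩ := hG
    exact ⟨n + m, Fin.append x x', Fin.append y y', by simp [Fin.sum_univ_add]⟩
  | smul c F _ hF =>
    obtain ⟨n, x, y, rfl⟩ := hF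
    exact ⟨n, fun i => c • x i, y, by simp [rankOne_smul_left, Finset.smul_sum]⟩

end Adjointable

/-! ### Spectral projections onto isolated points -/

/-- The spectral projection of a self-adjoint element at an isolated point `ν` of its spectrum. The
last property says that `p` is the largest projection on which `a` acts as `ν`. -/
theorem exists_isolated_spectral_projection {B : Type*} [CStarAlgebra B] {a : B}
    (ha : IsSelfAdjoint a) {ν : ℝ} (hν : ∀ᶠ w in 𝓝[≠] ν, w ∉ spectrum ℝ a) :
    ∃ p : B, IsSelfAdjoint p ∧ p * p = p ∧ a * p = ν • p ∧ ∃ g : B, 1 - p = g * (a - ν • 1) := by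
  have hev : ∀ᶠ w in 𝓝[spectrum ℝ a] ν, w = ν := by
    rw [eventually_nhdsWithin_iff] at hν ⊢
    filter_upwards [hν] with w hw hwa
    by_contra hne
    exact hw hne hwa
  -- A function is continuous on the spectrum as soon as it is continuous away from `ν`.
  have hcont : ∀ f : ℝ → ℝ, (∀ w, w ≠ ν → ContinuousAt f w) → ContinuousOn f (spectrum ℝ a) := by
    intro f hf w hw
    by_cases h : w = ν
    · subst h
      exact (continuousWithinAt_const (b := f w)).congr_of_eventuallyEq
        (hev.mono fun v hv => by rw [hv]) rfl
    · exact (hf w h).continuousWithinAt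
  set f : ℝ → ℝ := fun w => if w = ν then 1 else 0 with hf
  set g : ℝ → ℝ := fun w => if w = ν then 0 else (w - ν)⁻¹ with hg
  have hne : ∀ w, w ≠ ν → ∀ᶠ v in 𝓝 w, v ≠ ν := fun w hw => isOpen_ne.eventually_mem hw
  have hfc : ContinuousOn f (spectrum ℝ a) := hcont f fun w hw =>
    (continuousAt_const (y := (0 : ℝ))).congr ((hne w hw).mono fun v hv => by simp [hf, hv])
  have hgc : ContinuousOn g (spectrum ℝ a) := hcont g fun w hw =>
    ((continuousAt_id.sub continuousAt_const).inv₀ (sub_ne_zero.2 hw)).congr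
      ((hne w hw).mono fun v hv => by simp [hg, hv])
  refine ⟨cfc f a, IsSelfAdjoint.cfc, ?_, ?_, cfc g a, ?_⟩
  · rw [← cfc_mul f f a hfc hfc]
    exact cfc_congr fun w _ => by simp [hf]
  · nth_rw 1 [← cfc_id' ℝ a]
    rw [← cfc_mul (fun w => w) f a continuousOn_id hfc, ← cfc_smul ν f a hfc]
    refine cfc_congr fun w _ => ?_
    by_cases h : w = ν <;> simp [hf, h]
  · have h1 : a - ν • 1 = cfc (fun w => w - ν) a := by
      rw [cfc_sub (fun w => w) (fun _ => ν) a, cfc_id' ℝ a, cfc_const ν a,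
        Algebra.algebraMap_eq_smul_one]
    rw [h1, ← cfc_mul g _ a hgc (by fun_prop), ← cfc_one ℝ a, ← cfc_sub _ f a (by fun_prop) hfc]
    refine cfc_congr fun w _ => ?_
    by_cases h : w = ν
    · simp [hf, h]
    · simp [hf, hg, h, sub_ne_zero.2 h]

/-- The inverse of `w - r` is `w⁻² (w + r')`. -/
theorem isUnit_algebraMap_sub_of_resolvent_identity {B : Type*} [Ring B] [Algebra ℝ B] {w : ℝ}
    (hw : w ≠ 0) {r r' : B} (h : w • r' = w • r + r * r') (h' : w • r = w • r' - r' * r) :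
    IsUnit (algebraMap ℝ B w - r) := by
  have hww : w⁻¹ * w⁻¹ * (w * w) = 1 := by field_simp
  rw [Algebra.algebraMap_eq_smul_one]
  refine ⟨⟨w • (1 : B) - r, (w⁻¹ * w⁻¹) • (w • (1 : B) + r'), ?_, ?_⟩, rfl⟩
  · have : (w • (1 : B) - r) * (w • (1 : B) + r') = (w * w) • (1 : B) := by
      simp only [sub_mul, mul_add, smul_mul_assoc, mul_smul_comm, one_mul, mul_one, smul_sub, h]
      module
    rw [mul_smul_comm, this, smul_smul, hww, one_smul]
  · have : (w • (1 : B) + r') * (w • (1 : B) - r) = (w * w) • (1 : B) := by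
      simp only [add_mul, mul_sub, smul_mul_assoc, mul_smul_comm, one_mul, mul_one, smul_add, h']
      module
    rw [smul_mul_assoc, this, smul_smul, hww, one_smul]

/-! ### Resolvents and eigenprojections -/

section Eigen

variable {A E : Type*} [CStarAlgebra A] [PartialOrder A] [StarOrderedRing A]
  [NormedAddCommGroup E] [NormedSpace ℂ E] [Module A E] [CStarModule A E]

/-- The resolvent identity. -/
theorem IsResolventAt.sub_eq {X : Type*} [AddCommGroup X] [Module ℂ X] {G : Set (X × X)} {z μ : ℂ}
    {R R' : X → X} (hR : IsResolventAt G z R) (hR' : IsResolventAt G μ R')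
    (hadd : ∀ x y, R' (x + y) = R' x + R' y) (hsmul : ∀ (c : ℂ) x, R' (c • x) = c • R' x) (v : X) :
    R v = R' v + (z - μ) • R' (R v) := by
  obtain ⟨y, hy, hv⟩ := (hR v (R v)).1 rfl
  rw [← hsmul, ← hadd, eq_comm, hR']
  refine ⟨y, hy, ?_⟩
  calc y - μ • R v = (y - z • R v) + (z - μ) • R v := by module
    _ = _ := by rw [hv]

theorem IsSelfAdjointOp.inner_comm {D : E →ₗ.[A] E} (hD : IsSelfAdjointOp D) {x y x' y' : E}
    (h : (x, y) ∈ D.graph) (h' : (x', y') ∈ D.graph) : ⟪x, y'⟫_A = ⟪y, x'⟫_A := by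
  rw [hD.2] at h
  obtain ⟨u, hu, hu'⟩ := (LinearPMap.mem_graph_iff D).1 h'
  have := h u
  simpa only [hu, hu'] using this

theorem isSelfAdjoint_resolvent {D : E →ₗ.[A] E} (hD : IsSelfAdjointOp D) {μ : ℝ}
    {R : adjointableAlgebra A E} (hR : IsResolventAt (D.graph : Set (E × E)) μ R.1) :
    IsSelfAdjoint R := by
  refine adjointableAlgebra.isSelfAdjoint_of fun x y => ?_
  obtain ⟨a, ha, hx⟩ := (hR x (R.1 x)).1 rfl
  obtain ⟨b, hb, hy⟩ := (hR y (R.1 y)).1 rfl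
  have := hD.inner_comm ha hb
  nth_rw 1 [← hx]
  nth_rw 2 [← hy]
  simp [this]

/-- If `D - z` is invertible with `z = μ + w⁻¹`, then `w` is not in the spectrum of
`(D - μ)⁻¹`. -/
theorem notMem_spectrum_resolvent {D : E →ₗ.[A] E} {μ w : ℝ} (hw : w ≠ 0)
    {R Rz : adjointableAlgebra A E} (hR : IsResolventAt (D.graph : Set (E × E)) μ R.1)
    (hRz : IsResolventAt (D.graph : Set (E × E)) ((μ + w⁻¹ : ℝ) : ℂ) Rz.1) :
    w ∉ spectrum ℝ R := by
  have e1 : w • Rz = w • R + R * Rz := by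
    ext v
    have := hRz.sub_eq hR (map_add _) (_root_.map_smul _) v
    simp only [Complex.ofReal_add, add_sub_cancel_left] at this
    have h2 := congrArg (fun u => (w : ℂ) • u) this
    simp only [smul_add, smul_smul, ← Complex.ofReal_mul, mul_inv_cancel₀ hw, Complex.ofReal_one,
      one_smul] at h2
    simpa using h2
  have e2 : w • R = w • Rz - Rz * R := by
    ext v
    have := hR.sub_eq hRz (map_add _) (_root_.map_smul _) v
    simp only [Complex.ofReal_add, sub_add_cancel_left] at this
    have h2 := congrArg (fun u => (w : ℂ) • u) this
    simp only [smul_add, smul_neg, neg_smul, smul_smul, ← Complex.ofReal_mul, mul_inv_cancel₀ hw,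
      Complex.ofReal_one, one_smul] at h2
    simpa [sub_eq_add_neg] using h2
  rw [spectrum.mem_iff, not_not]
  exact isUnit_algebraMap_sub_of_resolvent_identity hw e1 e2

variable [IsScalarTower ℂ A E]

theorem mem_eigenspace {D : E →ₗ.[A] E} {l : ℝ} {x : E} :
    x ∈ eigenspace D l ↔ (x, (l : ℂ) • x) ∈ D.graph := Iff.rfl

theorem IsProjectionOnto.mem_iff {P : E →L[ℂ] E} {N : Submodule A E}
    (hP : IsProjectionOnto A P N) {x : E} : x ∈ N ↔ P x = x := by
  rw [← SetLike.mem_coe, ← hP.range_eq]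
  exact ⟨by rintro ⟨y, rfl⟩; exact hP.idem y, fun h => ⟨x, h⟩⟩

theorem IsProjectionOnto.apply_mem {P : E →L[ℂ] E} {N : Submodule A E}
    (hP : IsProjectionOnto A P N) (x : E) : P x ∈ N := hP.mem_iff.2 (hP.idem x)

theorem IsProjectionOnto.mem_adjointableAlgebra {P : E →L[ℂ] E} {N : Submodule A E}
    (hP : IsProjectionOnto A P N) : P ∈ adjointableAlgebra A E := ⟨P, hP.symm⟩

theorem IsProjectionOnto.isClosed {P : E →L[ℂ] E} {N : Submodule A E}
    (hP : IsProjectionOnto A P N) : IsClosed (N : Set E) := by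
  have : (N : Set E) = {x | P x = x} := Set.ext fun x => hP.mem_iff
  rw [this]
  exact isClosed_eq P.continuous continuous_id

/-- The eigenprojection is the spectral projection of the resolvent `(D - μ)⁻¹`, for a real `μ` near
`l`, at the point `(l - μ)⁻¹`. -/
theorem exists_eigenprojection [CompleteSpace E] {D : E →ₗ.[A] E} (hD : IsSelfAdjointOp D) {l : ℝ}
    (hl : IsIsolatedIn (moduleSpectrum D) (l : ℂ)) :
    ∃ P : E →L[ℂ] E, IsProjectionOnto A P (eigenspace D l) := by
  obtain ⟨ε, hε, hiso⟩ := hl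
  have hres : ∀ z : ℝ, z ≠ l → dist z l < ε → ∃ R : adjointableAlgebra A E,
      IsResolventAt (D.graph : Set (E × E)) z R.1 := by
    intro z hz hd
    by_contra! h
    refine hz (Complex.ofReal_injective (hiso z ?_ ?_))
    · rintro ⟨R, hR, hRz⟩
      exact h ⟨R, hR⟩ hRz
    · rwa [Complex.dist_eq, ← Complex.ofReal_sub, Complex.norm_real]
  obtain ⟨R, hR⟩ := hres (l + ε / 2) (by linarith) (by
    rw [Real.dist_eq, add_sub_cancel_left, abs_of_pos (by linarith)]; linarith)
  set μ : ℝ := l + ε / 2 with hμ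
  have hμl : l - μ ≠ 0 := by rw [hμ]; linarith
  set ν : ℝ := (l - μ)⁻¹ with hν
  have hν0 : ν ≠ 0 := inv_ne_zero hμl
  -- The map `w ↦ μ + w⁻¹`, continuous at `ν`, carries the nonzero
  -- spectrum of `R` to that of `D`.
  have hev : ∀ᶠ w in 𝓝[≠] ν, w ∉ spectrum ℝ R := by
    have hc : ContinuousAt (fun w : ℝ => μ + w⁻¹) ν := by fun_prop (disch := assumption)
    have hlν : μ + ν⁻¹ = l := by rw [hν, inv_inv]; ring
    have h1 : ∀ᶠ w in 𝓝 ν, dist (μ + w⁻¹) l < ε :=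
      hlν ▸ hc.eventually (Metric.ball_mem_nhds (μ + ν⁻¹) hε)
    have h2 : ∀ᶠ w in 𝓝 ν, w ≠ 0 := isOpen_ne.eventually_mem hν0
    rw [eventually_nhdsWithin_iff]
    filter_upwards [h1, h2] with w hw1 hw2 hwν
    obtain ⟨Rz, hRz⟩ := hres (μ + w⁻¹)
      (fun h => hwν (inv_injective (by linarith [h, hlν]))) hw1
    exact notMem_spectrum_resolvent hw2 hR hRz
  obtain ⟨p, hp, hpp, hRp, g, hg⟩ :=
    exists_isolated_spectral_projection (isSelfAdjoint_resolvent hD hR) hev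
  have hmem : ∀ x, x ∈ eigenspace D l ↔ R.1 x = (ν : ℂ) • x := by
    intro x
    have hμl' : ((l - μ : ℝ) : ℂ) ≠ 0 := Complex.ofReal_ne_zero.2 hμl
    have h1 : R.1 x = (ν : ℂ) • x ↔ R.1 (((l - μ : ℝ) : ℂ) • x) = x := by
      rw [_root_.map_smul, hν, Complex.ofReal_inv, eq_inv_smul_iff₀ hμl']
    rw [h1, hR, mem_eigenspace]
    constructor
    · exact fun h => ⟨_, h, by rw [Complex.ofReal_sub, sub_smul]⟩
    · rintro ⟨y, hy, h⟩
      rw [Complex.ofReal_sub, sub_smul, sub_left_inj] at h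
      rwa [← h]
  refine ⟨p.1, ⟨fun x => ?_, fun x y => ?_, ?_⟩⟩
  · exact congrArg (fun T : adjointableAlgebra A E => T.1 x) hpp
  · exact (adjointableAlgebra.inner_comm_of_isSelfAdjoint hp x y).symm
  · ext x
    rw [SetLike.mem_coe, hmem]
    constructor
    · rintro ⟨y, rfl⟩
      have := congrArg (fun T : adjointableAlgebra A E => T.1 y) hRp
      simpa using this
    · intro h
      have := congrArg (fun T : adjointableAlgebra A E => T.1 x) hg
      have h0 : x - p.1 x = 0 := by simpa [h] using this
      exact ⟨x, (sub_eq_zero.1 h0).symm⟩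

/-- An adjointable idempotent in the closure of the `A`-finite operators is `A`-finite. -/
theorem mem_finiteOperators_of_idempotent [CompleteSpace E] {P : E →L[ℂ] E}
    (hP : P ∈ adjointableAlgebra A E) (hPP : P * P = P) (hc : P ∈ compactOperators A E) :
    P ∈ finiteOperators A E := by
  have hc' : P ∈ closure (finiteOperators A E : Set (E →L[ℂ] E)) := hc
  obtain ⟨F, hF, hd⟩ := Metric.mem_closure_iff.1 hc' (‖P‖ + 1)⁻¹ (by positivity)
  let p : adjointableAlgebra A E := ⟨P, hP⟩
  let G : adjointableAlgebra A E := ⟨F, finiteOperators_le hF⟩ * p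
  have hG : G.1 ∈ finiteOperators A E := mul_mem_finiteOperators_right p hF
  have hlt : ‖p - G‖ < 1 := by
    have h1 : p - G = (p - ⟨F, finiteOperators_le hF⟩) * p := by
      rw [sub_mul, show p * p = p from Subtype.ext hPP]
    rw [h1]
    calc _ ≤ ‖P - F‖ * ‖P‖ := norm_mul_le (P - F) P
      _ ≤ (‖P‖ + 1)⁻¹ * ‖P‖ := by
        gcongr
        rw [← dist_eq_norm]; exact hd.le
      _ < 1 := by rw [inv_mul_lt_one₀ (by positivity)]; linarith
  -- `U = 1 - (p - G)` is invertible and `U p = G`.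
  let U := Units.oneSub (p - G) hlt
  have hU : (U : adjointableAlgebra A E) * p = G := by
    have hGp : G * p = G := by
      change _ * p * p = _ * p
      rw [mul_assoc, show p * p = p from Subtype.ext hPP]
    change (1 - (p - G)) * p = G
    rw [sub_mul, sub_mul, show p * p = p from Subtype.ext hPP, hGp, one_mul]
    abel
  have h2 : p = (↑U⁻¹ : adjointableAlgebra A E) * G := by rw [← hU, Units.inv_mul_cancel_left]
  have h3 : P = (↑U⁻¹ : adjointableAlgebra A E).1 * G.1 := congrArg Subtype.val h2
  rw [h3]
  exact mul_mem_finiteOperators_left _ hG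

/-- On `ker (D - l)` the resolvent `(1 + D*D)⁻¹` is the scalar `(1 + l²)⁻¹`, so that the
eigenprojection is `A`-compact, and hence `A`-finite. -/
theorem IsElliptic.eigenprojection_mem_finiteOperators [CompleteSpace E] {D : E →ₗ.[A] E}
    (hD : IsElliptic D) (hDsa : IsSelfAdjointOp D) {l : ℝ} {P : E →L[ℂ] E}
    (hP : IsProjectionOnto A P (eigenspace D l)) : P ∈ finiteOperators A E := by
  obtain ⟨S, hS, hSD⟩ := hD.compact_resolvent
  have hSP : P = ((1 + l ^ 2 : ℝ) : ℂ) • (S * P) := by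
    ext x
    have hx := mem_eigenspace.1 (hP.apply_mem x)
    have h := (hSD (((1 + l ^ 2 : ℝ) : ℂ) • P x) (P x)).2 ⟨(l : ℂ) • (l : ℂ) • P x,
      ⟨(l : ℂ) • P x, hx, by
        rw [← hDsa.2]
        exact mem_eigenspace.1 ((eigenspace D l).smul_of_tower_mem (l : ℂ) (hP.apply_mem x))⟩, by
      push_cast; module⟩
    rw [_root_.map_smul] at h
    exact h.symm
  refine mem_finiteOperators_of_idempotent hP.mem_adjointableAlgebra
    (ContinuousLinearMap.ext hP.idem) ?_
  suffices S * P ∈ compactOperators A E from hSP ▸ Submodule.smul_mem _ _ this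
  have hcont : Continuous fun F : E →L[ℂ] E => F * P := continuous_id.mul continuous_const
  exact map_mem_closure (f := fun F : E →L[ℂ] E => F * P) hcont
    (show S ∈ closure (finiteOperators A E : Set (E →L[ℂ] E)) from hS)
    fun F hF => mul_mem_finiteOperators_right ⟨P, hP.mem_adjointableAlgebra⟩ hF

/-- If `P = ∑ i, π_{x i, y i}`, then `z ↦ (⟪y i, z⟫)_i` embeds the range of `P` as a direct summand
of `A ^ n`, with the retraction `c ↦ ∑ i, c i • P (x i)`. -/
theorem IsProjectionOnto.finite_and_projective {P : E →L[ℂ] E} {N : Submodule A E}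
    (hP : IsProjectionOnto A P N) (hF : P ∈ finiteOperators A E) :
    Module.Finite A N ∧ Module.Projective A N := by
  obtain ⟨n, x, y, hxy⟩ := exists_sum_rankOne hF
  let r : (Fin n → A) →ₗ[A] N :=
    Fintype.linearCombination A fun i => (⟨P (x i), hP.apply_mem _⟩ : N)
  let j : N →ₗ[A] (Fin n → A) :=
    { toFun := fun z i => ⟪y i, (z : E)⟫_A
      map_add' := fun z w => by ext i; simp
      map_smul' := fun a z => by ext i; simp }
  have hrj : r ∘ₗ j = LinearMap.id := by
    ext z
    have h1 : P (P z) = z := by rw [hP.idem, hP.mem_iff.1 z.2]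
    nth_rw 2 [hxy] at h1
    simpa [r, j, Fintype.linearCombination_apply, rankOne_apply,
      adjointableAlgebra.map_smul ⟨P, hP.mem_adjointableAlgebra⟩] using h1
  refine ⟨Module.Finite.of_surjective r fun z => ⟨j z, ?_⟩, Module.Projective.of_split j r hrj⟩
  exact LinearMap.congr_fun hrj z

end Eigen

/-! ### Quadratic forms, frames and approximate units -/

section FunctionalCalculus

variable {B : Type*} [CStarAlgebra B] {a : B}

theorem exists_inv_sqrt (ha : IsSelfAdjoint a) (hpos : ∀ t ∈ spectrum ℝ a, 0 < t) :
    ∃ b : B, IsSelfAdjoint b ∧ b * a * b = 1 ∧ ∀ p, Commute a p → Commute b p := by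
  have hc : ContinuousOn (fun t : ℝ => (√t)⁻¹) (spectrum ℝ a) :=
    Real.continuous_sqrt.continuousOn.inv₀ fun t ht => (Real.sqrt_pos.2 (hpos t ht)).ne'
  have hc' : ContinuousOn (fun t : ℝ => (√t)⁻¹ * t) (spectrum ℝ a) := hc.mul continuousOn_id
  refine ⟨cfc (fun t : ℝ => (√t)⁻¹) a, IsSelfAdjoint.cfc, ?_, fun p hp => ha.commute_cfc hp _⟩
  conv_lhs => enter [1, 2]; rw [← cfc_id' ℝ a]
  rw [← cfc_mul _ (fun t => t) a hc continuousOn_id,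
    ← cfc_mul _ _ a hc' hc, ← cfc_one ℝ a]
  refine cfc_congr fun t ht => ?_
  have h1 : √t * √t = t := Real.mul_self_sqrt (hpos t ht).le
  have h2 : √t ≠ 0 := (Real.sqrt_pos.2 (hpos t ht)).ne'
  calc (√t)⁻¹ * t * (√t)⁻¹ = (√t)⁻¹ * (√t * √t) * (√t)⁻¹ := by rw [h1]
    _ = 1 := by field_simp

/-- With `g = a (a² + s²)⁻¹` and `w = 1 - g a = s² (a² + s²)⁻¹`, the product `w a w` is small. -/
theorem exists_sandwich_norm_le (ha : IsSelfAdjoint a) {s : ℝ} (hs : 0 < s) :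
    ∃ g w : B, IsSelfAdjoint w ∧ w = 1 - g * a ∧ ‖w * a * w‖ ≤ s := by
  have hpos : ∀ t : ℝ, 0 < t ^ 2 + s ^ 2 := fun t => by positivity
  have hne : ∀ t : ℝ, t ^ 2 + s ^ 2 ≠ 0 := fun t => (hpos t).ne'
  have hg : Continuous fun t : ℝ => t / (t ^ 2 + s ^ 2) :=
    continuous_id.div (by fun_prop) hne
  have hw : Continuous fun t : ℝ => s ^ 2 / (t ^ 2 + s ^ 2) :=
    continuous_const.div (by fun_prop) hne
  have hg' : Continuous fun t : ℝ => t / (t ^ 2 + s ^ 2) * t := hg.mul continuous_id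
  have hw' : Continuous fun t : ℝ => s ^ 2 / (t ^ 2 + s ^ 2) * t := hw.mul continuous_id
  refine ⟨cfc (fun t : ℝ => t / (t ^ 2 + s ^ 2)) a, cfc (fun t : ℝ => s ^ 2 / (t ^ 2 + s ^ 2)) a,
    IsSelfAdjoint.cfc, ?_, ?_⟩
  · conv_rhs => enter [2, 2]; rw [← cfc_id' ℝ a]
    rw [← cfc_mul _ (fun t => t) a hg.continuousOn continuousOn_id, ← cfc_const_one ℝ a,
      ← cfc_sub _ _ a continuousOn_const hg'.continuousOn]
    refine cfc_congr fun t _ => ?_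
    have := hne t
    field_simp
    ring
  · conv_lhs => enter [1, 1, 2]; rw [← cfc_id' ℝ a]
    rw [← cfc_mul _ (fun t => t) a hw.continuousOn continuousOn_id,
      ← cfc_mul _ _ a hw'.continuousOn hw.continuousOn]
    refine norm_cfc_le hs.le fun t _ => ?_
    have h0 := hpos t
    have h1 : s ^ 2 / (t ^ 2 + s ^ 2) * t * (s ^ 2 / (t ^ 2 + s ^ 2)) =
        s ^ 4 * t / (t ^ 2 + s ^ 2) ^ 2 := by field_simp
    rw [h1, Real.norm_eq_abs, abs_div, abs_mul, abs_of_pos (by positivity : 0 < s ^ 4),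
      abs_of_pos (by positivity : 0 < (t ^ 2 + s ^ 2) ^ 2), div_le_iff₀ (by positivity)]
    have h2 : 2 * s * |t| ≤ t ^ 2 + s ^ 2 := by nlinarith [sq_nonneg (|t| - s), sq_abs t]
    calc s ^ 4 * |t| ≤ s * (s ^ 2 * (2 * s * |t|)) := by
          have : 0 ≤ s ^ 4 * |t| := by positivity
          nlinarith
      _ ≤ s * ((t ^ 2 + s ^ 2) * (t ^ 2 + s ^ 2)) := by
          gcongr
          nlinarith [sq_nonneg t]
      _ = _ := by ring

end FunctionalCalculus

section Frame

variable {A E : Type*} [CStarAlgebra A] [PartialOrder A] [StarOrderedRing A]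
  [NormedAddCommGroup E] [NormedSpace ℂ E] [Module A E] [CStarModule A E]

/-- A lower bound of the `A`-valued quadratic form of a self-adjoint operator is a lower bound of
its spectrum. -/
theorem le_of_mem_spectrum [CompleteSpace E] {T : adjointableAlgebra A E} (hT : IsSelfAdjoint T)
    {c : ℝ} (hc : ∀ x : E, c • ⟪x, x⟫_A ≤ ⟪x, T.1 x⟫_A) {t : ℝ} (ht : t ∈ spectrum ℝ T) :
    c ≤ t := by
  set M := cfc (fun s : ℝ => max (c - s) 0) T with hM
  set N := cfc (fun s : ℝ => √(max (c - s) 0)) T with hN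
  -- With `M` the negative part of `T - c` and `N` its square root, `N (T - c) N = -M²`.
  have key : N * (T - c • 1) * N = -(M * M) := by
    have h1 : T - c • 1 = cfc (fun s : ℝ => s - c) T := by
      rw [cfc_sub (fun s : ℝ => s) (fun _ => c) T, cfc_id' ℝ T, cfc_const c T,
        Algebra.algebraMap_eq_smul_one]
    rw [h1, hN, hM, ← cfc_mul _ _ T (by fun_prop) (by fun_prop),
      ← cfc_mul _ _ T (by fun_prop) (by fun_prop), ← cfc_mul _ _ T (by fun_prop) (by fun_prop),
      ← cfc_neg]
    refine cfc_congr fun s _ => ?_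
    have h2 : √(max (c - s) 0) * √(max (c - s) 0) = max (c - s) 0 :=
      Real.mul_self_sqrt (le_max_right _ _)
    have h3 : (s - c) * max (c - s) 0 = -(max (c - s) 0 * max (c - s) 0) := by
      rcases le_total (c - s) 0 with h | h
      · simp [max_eq_right h]
      · rw [max_eq_left h]; ring
    rw [← h3]
    linear_combination (s - c) * h2
  have hM0 : M = 0 := by
    ext x
    have h1 : ⟪x, (N * (T - c • 1) * N).1 x⟫_A = -⟪M.1 x, M.1 x⟫_A := by
      rw [key, adjointableAlgebra.inner_comm_of_isSelfAdjoint (IsSelfAdjoint.cfc)]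
      simp
    have h2 : 0 ≤ ⟪x, (N * (T - c • 1) * N).1 x⟫_A := by
      have h3 : ⟪x, (N * (T - c • 1) * N).1 x⟫_A =
          ⟪N.1 x, T.1 (N.1 x)⟫_A - c • ⟪N.1 x, N.1 x⟫_A := by
        have := adjointableAlgebra.inner_comm_of_isSelfAdjoint (T := N) IsSelfAdjoint.cfc x
          ((T - c • 1).1 (N.1 x))
        rw [← CStarModule.inner_smul_right_real, ← CStarModule.inner_sub_right]
        exact this.symm
      rw [h3]
      exact sub_nonneg.2 (hc _)
    rw [h1, neg_nonneg] at h2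
    exact CStarModule.inner_self.1 (le_antisymm h2 CStarModule.inner_self_nonneg)
  have h4 := norm_apply_le_norm_cfc (fun s : ℝ => max (c - s) 0) T ht (by fun_prop)
  rw [← hM, hM0, norm_zero, Real.norm_eq_abs] at h4
  have := abs_nonpos_iff.1 h4
  linarith [le_max_left (c - t) 0]

/-- A crude form of the Cauchy-Schwarz inequality for finite sums. -/
theorem exists_inner_sum_le {ι : Type*} (s : Finset ι) :
    ∃ C : ℝ, 0 ≤ C ∧ ∀ v : ι → E, ⟪∑ i ∈ s, v i, ∑ i ∈ s, v i⟫_A ≤ C • ∑ i ∈ s, ⟪v i, v i⟫_A := by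
  classical
  induction s using Finset.induction_on with
  | empty => exact ⟨0, le_rfl, fun v => by simp⟩
  | insert a s ha ih =>
    obtain ⟨C, hC, h⟩ := ih
    refine ⟨2 * (1 + C), by positivity, fun v => ?_⟩
    rw [Finset.sum_insert ha, Finset.sum_insert ha]
    set w := ∑ i ∈ s, v i
    have h1 : (0 : A) ≤ ⟪v a - w, v a - w⟫_A := CStarModule.inner_self_nonneg
    have h2 : ⟪v a + w, v a + w⟫_A + ⟪v a - w, v a - w⟫_A =
        (2 : ℝ) • ⟪v a, v a⟫_A + (2 : ℝ) • ⟪w, w⟫_A := by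
      simp only [CStarModule.inner_add_left, CStarModule.inner_add_right,
        CStarModule.inner_sub_left, CStarModule.inner_sub_right]
      module
    have h3 : (0 : A) ≤ ⟪v a, v a⟫_A := CStarModule.inner_self_nonneg
    have h4 : (0 : A) ≤ ∑ i ∈ s, ⟪v i, v i⟫_A :=
      Finset.sum_nonneg fun i _ => CStarModule.inner_self_nonneg
    calc ⟪v a + w, v a + w⟫_A ≤ ⟪v a + w, v a + w⟫_A + ⟪v a - w, v a - w⟫_A :=
          le_add_of_nonneg_right h1
      _ = (2 : ℝ) • ⟪v a, v a⟫_A + (2 : ℝ) • ⟪w, w⟫_A := h2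
      _ ≤ (2 * (1 + C)) • ⟪v a, v a⟫_A + (2 : ℝ) • ((1 + C) • ∑ i ∈ s, ⟪v i, v i⟫_A) := by
        gcongr
        · linarith
        · refine (h v).trans ?_
          gcongr
          linarith
      _ = _ := by module

variable [IsScalarTower ℂ A E]

theorem inner_rankOne_self_nonneg (x z : E) : 0 ≤ ⟪z, rankOne A x x z⟫_A := by
  rw [inner_rankOne, ← CStarModule.star_inner]
  exact star_mul_self_nonneg _

/-- `⟪P z, P z⟫` is bounded by the quadratic form of `∑ i, π_{y i, y i}` if
`P = ∑ i, π_{x i, y i}`. -/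
theorem exists_inner_sum_rankOne_le {ι : Type*} [Fintype ι] (x y : ι → E) :
    ∃ C : ℝ, 0 ≤ C ∧ ∀ z : E, ⟪(∑ i, rankOne A (x i) (y i)) z, (∑ i, rankOne A (x i) (y i)) z⟫_A ≤
      C • ⟪z, (∑ i, rankOne A (y i) (y i)) z⟫_A := by
  obtain ⟨C, hC, h⟩ := exists_inner_sum_le (A := A) (E := E) (Finset.univ : Finset ι)
  refine ⟨C * ∑ i, ‖x i‖ ^ 2, by positivity, fun z => ?_⟩
  simp only [sum_apply, CStarModule.inner_sum_right (E := E) (x := z)]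
  refine (h _).trans ?_
  rw [mul_smul]
  refine smul_le_smul_of_nonneg_left ?_ hC
  rw [Finset.smul_sum]
  refine Finset.sum_le_sum fun i _ => ?_
  rw [rankOne_apply, CStarModule.inner_op_smul_left, CStarModule.inner_op_smul_right, inner_rankOne]
  have h0 : 0 ≤ ⟪y i, z⟫_A * ⟪z, y i⟫_A := by
    rw [← CStarModule.star_inner z]; exact star_mul_self_nonneg _
  calc _ ≤ ‖⟪x i, x i⟫_A‖ • (⟪y i, z⟫_A * star ⟪y i, z⟫_A) :=
        CStarAlgebra.star_right_conjugate_le_norm_smul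
    _ = ‖x i‖ ^ 2 • (⟪y i, z⟫_A * ⟪z, y i⟫_A) := by
        rw [CStarModule.norm_sq_eq A, CStarModule.star_inner]
    _ ≤ _ := by
        gcongr
        exact Finset.single_le_sum (f := fun i => ‖x i‖ ^ 2) (fun j _ => by positivity)
          (Finset.mem_univ i)

/-- An `A`-finite projection has a frame. If `P = ∑ i, π_{x i, y i}` with `y i` in the range of
`P`, then `∑ i, π_{y i, y i} + (1 - P)` is bounded below, and its inverse square root maps `y` to a
frame. -/
theorem IsProjectionOnto.exists_frame [CompleteSpace E] {P : E →L[ℂ] E} {N : Submodule A E}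
    (hP : IsProjectionOnto A P N) (hF : P ∈ finiteOperators A E) :
    ∃ (n : ℕ) (u : Fin n → E), P = ∑ i, rankOne A (u i) (u i) ∧ ∀ i, P (u i) = u i := by
  obtain ⟨n, x, y, hxy⟩ := exists_sum_rankOne hF
  let p : adjointableAlgebra A E := ⟨P, hP.mem_adjointableAlgebra⟩
  have hp : IsSelfAdjoint p := adjointableAlgebra.isSelfAdjoint_of hP.symm
  have hpp : p * p = p := Subtype.ext (ContinuousLinearMap.ext hP.idem)
  -- As `P = P P*`, the vectors `y i` may be replaced by `P (y i)`.
  let v : Fin n → E := fun i => P (y i)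
  have hPv : P = ∑ i, rankOne A (x i) (v i) := by
    have h1 : P * p.1 = P := ContinuousLinearMap.ext hP.idem
    conv_lhs => rw [← h1, hxy, Finset.sum_mul]
    refine Finset.sum_congr rfl fun i _ => ?_
    rw [rankOne_mul_adjointable, hp.star_eq]
  let Y : adjointableAlgebra A E :=
    ∑ i, ⟨rankOne A (v i) (v i), rankOne_mem_adjointableAlgebra _ _⟩
  have hYv : Y.1 = ∑ i, rankOne A (v i) (v i) := by simp [Y]
  have hYsa : IsSelfAdjoint Y := adjointableAlgebra.isSelfAdjoint_of fun a b => by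
    simp [hYv, inner_rankOne_comm]
  have hpY : p * Y = Y := by
    ext z
    simp [hYv, p, rankOne_apply, v, adjointableAlgebra.map_smul p, hP.idem]
  have hYp : Y * p = Y := by
    have := congrArg star hpY
    rwa [star_mul, hp.star_eq, hYsa.star_eq] at this
  set T : adjointableAlgebra A E := Y + (1 - p) with hTdef
  have hT : IsSelfAdjoint T := hYsa.add ((IsSelfAdjoint.one _).sub hp)
  have hTp : T * p = Y := by rw [hTdef, add_mul, sub_mul, hpp, hYp, one_mul, sub_self, add_zero]
  have hpT : p * T = Y := by rw [hTdef, mul_add, mul_sub, hpp, hpY, mul_one, sub_self, add_zero]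
  obtain ⟨C, hC, hle⟩ := exists_inner_sum_rankOne_le (A := A) x v
  rw [← hPv, ← hYv] at hle
  have hpos : ∀ t ∈ spectrum ℝ T, 0 < t := by
    intro t ht
    refine lt_of_lt_of_le (inv_pos.2 (by positivity : 0 < C + 1)) (le_of_mem_spectrum hT ?_ ht)
    intro z
    have h1 : ⟪P z, P z⟫_A = ⟪z, P z⟫_A := by rw [← hP.symm, hP.idem]
    have h2 : 0 ≤ ⟪z, Y.1 z⟫_A := by
      rw [hYv, sum_apply, CStarModule.inner_sum_right]
      exact Finset.sum_nonneg fun i _ => inner_rankOne_self_nonneg _ _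
    have h3 : 0 ≤ ⟪z, z⟫_A - ⟪z, P z⟫_A := by
      have h4 : ⟪z - P z, z - P z⟫_A = ⟪z, z⟫_A - ⟪z, P z⟫_A := by
        simp [h1, ← hP.symm]
      rw [← h4]
      exact CStarModule.inner_self_nonneg
    have h5 : ⟪z, T.1 z⟫_A = ⟪z, Y.1 z⟫_A + (⟪z, z⟫_A - ⟪z, P z⟫_A) := by
      simp [hTdef, p]
    rw [inv_smul_le_iff_of_pos (by positivity), h5]
    calc ⟪z, z⟫_A = ⟪P z, P z⟫_A + (⟪z, z⟫_A - ⟪z, P z⟫_A) := by rw [h1]; abel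
      _ ≤ C • ⟪z, Y.1 z⟫_A + (⟪z, z⟫_A - ⟪z, P z⟫_A) := by gcongr; exact hle z
      _ ≤ C • ⟪z, Y.1 z⟫_A + (⟪z, z⟫_A - ⟪z, P z⟫_A) +
          (⟪z, Y.1 z⟫_A + C • (⟪z, z⟫_A - ⟪z, P z⟫_A)) :=
        le_add_of_nonneg_right (add_nonneg h2 (smul_nonneg hC h3))
      _ = _ := by module
  obtain ⟨B, hBsa, hBTB, hcomm⟩ := exists_inv_sqrt hT hpos
  replace hcomm : Commute B p := hcomm p (show T * p = p * T by rw [hTp, hpT])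
  have hBYB : B * Y * B = p := by
    rw [← hTp, mul_assoc, mul_assoc, ← hcomm.eq, ← mul_assoc, ← mul_assoc, hBTB, one_mul]
  refine ⟨n, fun i => B.1 (v i), ?_, fun i => ?_⟩
  · have h1 : P = B.1 * Y.1 * B.1 := (congrArg Subtype.val hBYB).symm
    rw [h1, hYv, Finset.mul_sum, Finset.sum_mul]
    refine Finset.sum_congr rfl fun i _ => ?_
    rw [adjointable_mul_rankOne, rankOne_mul_adjointable, hBsa.star_eq]
  · have h1 : p.1 (B.1 (v i)) = B.1 (p.1 (v i)) :=
      congrArg (fun S : adjointableAlgebra A E => S.1 (v i)) hcomm.eq.symm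
    have h2 : p.1 (v i) = v i := hP.idem _
    rw [h2] at h1
    exact h1

/-- The `A`-finite operators act as an approximate unit on finite families of vectors: with
`X = ∑ i, π_{x i, x i}`, the operators `X² (X² + s²)⁻¹` do, for `s → 0`. -/
theorem exists_finite_approximate_unit [CompleteSpace E] {ι : Type*} [Fintype ι] (x : ι → E)
    {ε : ℝ} (hε : 0 < ε) :
    ∃ v : ι → E, ∀ i, ‖x i - (∑ k, rankOne A (v k) (x k)) (x i)‖ ≤ ε := by
  let X : adjointableAlgebra A E :=
    ∑ i, ⟨rankOne A (x i) (x i), rankOne_mem_adjointableAlgebra _ _⟩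
  have hXx : X.1 = ∑ i, rankOne A (x i) (x i) := by simp [X]
  have hX : IsSelfAdjoint X := adjointableAlgebra.isSelfAdjoint_of fun a b => by
    simp [hXx, inner_rankOne_comm]
  obtain ⟨G, W, hWsa, hWG, hWXW⟩ := exists_sandwich_norm_le hX (sq_pos_of_pos hε)
  refine ⟨fun k => G.1 (x k), fun i => ?_⟩
  have h1 : x i - (∑ k, rankOne A (G.1 (x k)) (x k)) (x i) = W.1 (x i) := by
    have h2 : ∑ k, rankOne A (G.1 (x k)) (x k) = G.1 * X.1 := by
      rw [hXx, Finset.mul_sum]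
      exact Finset.sum_congr rfl fun k _ => (adjointable_mul_rankOne G _ _).symm
    rw [h2, hWG]
    rfl
  rw [h1]
  set w := W.1 (x i) with hw
  -- This is `π_{w,w} ≤ W X W`, evaluated at `w`; it gives `‖w‖ ^ 4 ≤ ε ^ 2 * ‖w‖ ^ 2`.
  have h3 : ⟪w, w⟫_A * ⟪w, w⟫_A ≤ ⟪w, (W * X * W).1 w⟫_A := by
    have h4 : (W * X * W).1 = ∑ k, rankOne A (W.1 (x k)) (W.1 (x k)) := by
      change W.1 * X.1 * W.1 = _
      rw [hXx, Finset.mul_sum, Finset.sum_mul]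
      refine Finset.sum_congr rfl fun k _ => ?_
      rw [adjointable_mul_rankOne, rankOne_mul_adjointable, hWsa.star_eq]
    rw [h4, sum_apply, CStarModule.inner_sum_right, ← inner_rankOne]
    exact Finset.single_le_sum (f := fun k => ⟪w, rankOne A (W.1 (x k)) (W.1 (x k)) w⟫_A)
      (fun k _ => inner_rankOne_self_nonneg _ _) (Finset.mem_univ i)
  have h5 : ‖w‖ ^ 2 * ‖w‖ ^ 2 ≤ ε ^ 2 * ‖w‖ ^ 2 := by
    have hsa : IsSelfAdjoint ⟪w, w⟫_A := CStarModule.isSelfAdjoint_inner_self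
    calc ‖w‖ ^ 2 * ‖w‖ ^ 2 = ‖⟪w, w⟫_A * ⟪w, w⟫_A‖ := by
          rw [hsa.norm_mul_self, CStarModule.norm_sq_eq A, sq]
      _ ≤ ‖⟪w, (W * X * W).1 w⟫_A‖ :=
          CStarAlgebra.norm_le_norm_of_nonneg_of_le (by
            nth_rw 1 [← hsa.star_eq]; exact star_mul_self_nonneg _) h3
      _ ≤ ‖w‖ * (‖W * X * W‖ * ‖w‖) :=
          (CStarModule.norm_inner_le E).trans (by gcongr; exact (W * X * W).1.le_opNorm w)
      _ ≤ ‖w‖ * (ε ^ 2 * ‖w‖) := by gcongr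
      _ = _ := by ring
  rcases (norm_nonneg w).eq_or_lt with h0 | h0
  · rw [← h0]; exact hε.le
  · have h6 : ‖w‖ ^ 2 ≤ ε ^ 2 := le_of_mul_le_mul_right h5 (by positivity)
    exact le_of_sq_le_sq h6 hε.le

end Frame

/-! ### The trace of an `A`-finite projection -/

section Trace

variable {A E : Type*} [CStarAlgebra A] [PartialOrder A] [StarOrderedRing A]
  [NormedAddCommGroup E] [NormedSpace ℂ E] [Module A E] [CStarModule A E] [IsScalarTower ℂ A E]
  {τ : A →ₚ[ℂ] ℂ}

/-- The trace property `tr_τ (F T) = tr_τ (T F)` for `A`-finite operators. -/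
theorem sum_trace_comm (hτ : IsFaithfulTrace τ) {ι κ : Type*} [Fintype ι] [Fintype κ]
    (x y : ι → E) (v w : κ → E) :
    ∑ i, τ ⟪y i, (∑ k, rankOne A (v k) (w k)) (x i)⟫_A =
      ∑ k, τ ⟪w k, (∑ i, rankOne A (x i) (y i)) (v k)⟫_A := by
  simp only [sum_apply, CStarModule.inner_sum_right, map_sum, inner_rankOne]
  rw [Finset.sum_comm]
  exact Finset.sum_congr rfl fun k _ => Finset.sum_congr rfl fun i _ => hτ.trace _ _

/-- The value `∑ i, τ ⟪y i, x i⟫` depends only on the operator `∑ i, π_{x i, y i}`. -/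
theorem sum_trace_eq_zero [CompleteSpace E] (hτ : IsFaithfulTrace τ) {ι : Type*} [Fintype ι]
    (x y : ι → E) (h : ∑ i, rankOne A (x i) (y i) = 0) : ∑ i, τ ⟪y i, x i⟫_A = 0 := by
  obtain ⟨C, hC⟩ := PositiveLinearMap.exists_norm_apply_le τ
  have key : ∀ ε > 0, ‖∑ i, τ ⟪y i, x i⟫_A‖ ≤ (∑ i, C * ‖y i‖) * ε := by
    intro ε hε
    obtain ⟨v, hv⟩ := exists_finite_approximate_unit (A := A) x hε
    have h1 : ∑ i, τ ⟪y i, (∑ k, rankOne A (v k) (x k)) (x i)⟫_A = 0 := by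
      rw [sum_trace_comm hτ, h]
      simp
    have h2 : ∑ i, τ ⟪y i, x i⟫_A =
        ∑ i, τ ⟪y i, x i - (∑ k, rankOne A (v k) (x k)) (x i)⟫_A := by
      simp only [CStarModule.inner_sub_right, map_sub, Finset.sum_sub_distrib, h1, sub_zero]
    rw [h2, Finset.sum_mul]
    refine norm_sum_le_of_le _ fun i _ => (hC _).trans ?_
    rw [mul_assoc]
    gcongr
    refine (CStarModule.norm_inner_le E).trans ?_
    gcongr
    exact hv i
  have hlim : Tendsto (fun ε : ℝ => (∑ i, C * ‖y i‖) * ε) (𝓝[>] 0) (𝓝 0) := by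
    have : Continuous fun ε : ℝ => (∑ i, C * ‖y i‖) * ε := by fun_prop
    simpa using (this.tendsto 0).mono_left nhdsWithin_le_nhds
  exact norm_le_zero_iff.1
    (ge_of_tendsto hlim (eventually_mem_nhdsWithin.mono fun ε hε => key ε hε))

theorem sum_trace_congr [CompleteSpace E] (hτ : IsFaithfulTrace τ) {ι κ : Type*} [Fintype ι]
    [Fintype κ] (x y : ι → E) (v w : κ → E)
    (h : ∑ i, rankOne A (x i) (y i) = ∑ k, rankOne A (v k) (w k)) :
    ∑ i, τ ⟪y i, x i⟫_A = ∑ k, τ ⟪w k, v k⟫_A := by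
  have := sum_trace_eq_zero hτ (Sum.elim x fun k => -v k) (Sum.elim y w)
    (by simp [rankOne_neg_left, h])
  simpa [add_neg_eq_zero] using this

theorem trace_inner_self_nonneg (x : E) : 0 ≤ τ ⟪x, x⟫_A :=
  τ.map_nonneg CStarModule.inner_self_nonneg

/-- A family with `∑ i, π_{x i, x i} ≤ P` lies in the range of the projection `P`. -/
theorem IsProjectionOnto.apply_eq_of_sum_le {P : E →L[ℂ] E} {N : Submodule A E}
    (hP : IsProjectionOnto A P N) {ι : Type*} [Fintype ι] {x : ι → E}
    (hx : IsPositiveOperator A (P - ∑ i, rankOne A (x i) (x i))) (i : ι) : P (x i) = x i := by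
  set q := x i - P (x i) with hq
  have hPq : P q = 0 := by rw [hq, map_sub, hP.idem, sub_self]
  have h1 := hx.2 q
  rw [sub_apply, CStarModule.inner_sub_right, hPq, CStarModule.inner_zero_right,
    zero_sub, neg_nonneg, sum_apply, CStarModule.inner_sum_right] at h1
  have h2 := (Finset.sum_eq_zero_iff_of_nonneg fun k _ => inner_rankOne_self_nonneg (x k) q).1
    (le_antisymm h1 (Finset.sum_nonneg fun k _ => inner_rankOne_self_nonneg (x k) q)) i
    (Finset.mem_univ i)
  rw [inner_rankOne, ← CStarModule.star_inner, CStarRing.star_mul_self_eq_zero_iff] at h2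
  have h3 : ⟪q, q⟫_A = 0 := by
    nth_rw 2 [hq]
    rw [CStarModule.inner_sub_right, h2, hP.symm, hPq, CStarModule.inner_zero_left, sub_zero]
  exact (sub_eq_zero.1 (CStarModule.inner_self.1 h3)).symm

theorem IsProjectionOnto.isPositiveOperator {P : E →L[ℂ] E} {N : Submodule A E}
    (hP : IsProjectionOnto A P N) : IsPositiveOperator A P :=
  ⟨hP.mem_adjointableAlgebra, fun x => by
    rw [← hP.idem, hP.symm]
    exact CStarModule.inner_self_nonneg⟩

/-- The supremum defining `tr_τ P` is attained at any frame of `P`. -/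
theorem trTau_eq_of_frame (hτ : IsFaithfulTrace τ) {P : E →L[ℂ] E} {N : Submodule A E}
    (hP : IsProjectionOnto A P N) {n : ℕ} {u : Fin n → E} (hu : P = ∑ i, rankOne A (u i) (u i))
    (hPu : ∀ i, P (u i) = u i) : trTau τ P = ENNReal.ofReal (∑ i, (τ ⟪u i, u i⟫_A).re) := by
  refine le_antisymm (iSup_le fun m => iSup_le fun x => iSup_le fun hx => ?_) ?_
  · refine ENNReal.ofReal_le_ofReal ?_
    rw [← Complex.re_sum, ← Complex.re_sum]
    have h1 : ∑ i, τ ⟪x i, x i⟫_A = ∑ k, τ ⟪u k, (∑ i, rankOne A (x i) (x i)) (u k)⟫_A := by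
      rw [← sum_trace_comm hτ, ← hu]
      exact Finset.sum_congr rfl fun i _ => by rw [hP.apply_eq_of_sum_le hx]
    rw [h1]
    refine (Complex.le_def.1 (Finset.sum_le_sum fun k _ => ?_)).1
    refine OrderHomClass.mono τ ?_
    have h2 := hx.2 (u k)
    rwa [sub_apply, CStarModule.inner_sub_right, hPu, sub_nonneg] at h2
  · refine le_iSup_of_le n (le_iSup_of_le u (le_iSup_of_le ?_ le_rfl))
    rw [← hu, sub_self]
    exact ⟨⟨0, fun x y => by simp⟩, fun x => by simp⟩

/-- An `A`-finite projection is trace class, and its trace is computed by any representation as a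
sum of operators `π_{x,y}`. -/
theorem IsProjectionOnto.mem_traceClass [CompleteSpace E] (hτ : IsFaithfulTrace τ)
    {P : E →L[ℂ] E} {N : Submodule A E} (hP : IsProjectionOnto A P N)
    (hF : P ∈ finiteOperators A E) :
    P ∈ traceClass τ ∧ trTau τ P ≠ ⊤ ∧
      ∀ (n : ℕ) (x y : Fin n → E), P = ∑ i, rankOne A (x i) (y i) →
        ∑ i, τ (inner A (y i) (x i)) = ((trTau τ P).toReal : ℂ) := by
  obtain ⟨m, u, hu, hPu⟩ := hP.exists_frame hF
  have htr := trTau_eq_of_frame hτ hP hu hPu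
  have hfin : trTau τ P ≠ ⊤ := by rw [htr]; exact ENNReal.ofReal_ne_top
  refine ⟨Submodule.subset_span ⟨hP.isPositiveOperator, hfin⟩, hfin, fun n x y hxy => ?_⟩
  rw [sum_trace_congr hτ x y u u (hxy.symm.trans hu), htr, ENNReal.toReal_ofReal
    (Finset.sum_nonneg fun i _ => (Complex.le_def.1 (trace_inner_self_nonneg (u i))).1)]
  rw [Complex.ofReal_sum]
  exact Finset.sum_congr rfl fun i _ => Complex.eq_re_of_ofReal_le (trace_inner_self_nonneg (u i))

end Trace

/-! ### The trace of a projection on a Hilbert space -/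

section HilbertTrace

variable {H : Type*} [NormedAddCommGroup H] [InnerProductSpace ℂ H]

theorem exists_orthonormal_of_not_finiteDimensional {M : Submodule ℂ H}
    (hM : ¬ FiniteDimensional ℂ M) (n : ℕ) :
    ∃ f : Fin n → H, Orthonormal ℂ f ∧ ∀ k, f k ∈ M := by
  have h : (n : Cardinal) ≤ Module.rank ℂ M :=
    (Cardinal.natCast_lt_aleph0).le.trans
      (not_lt.1 fun h => hM (Module.rank_lt_aleph0_iff.1 h))
  obtain ⟨f, hf⟩ := exists_linearIndependent_of_le_rank h
  exact ⟨fun k => (InnerProductSpace.gramSchmidtNormed ℂ f k : M),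
    (InnerProductSpace.gramSchmidtNormed_orthonormal hf).comp_linearIsometry M.subtypeₗᵢ,
    fun k => Subtype.coe_prop _⟩

theorem tsum_ofReal_norm_inner_sq {ι : Type*} (b : HilbertBasis ι ℂ H) (x : H) :
    ∑' i, ENNReal.ofReal (‖⟪b i, x⟫_ℂ‖ ^ 2) = ENNReal.ofReal (‖x‖ ^ 2) := by
  have h : HasSum (fun i => ‖⟪b i, x⟫_ℂ‖ ^ 2) (‖x‖ ^ 2) := by
    have h1 := (b.hasSum_inner_mul_inner x x).mapL Complex.reCLM
    convert h1 using 1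
    · ext i
      rw [Complex.reCLM_apply, ← inner_conj_symm x, Complex.conj_mul', ← Complex.ofReal_pow,
        Complex.ofReal_re]
    · rw [Complex.reCLM_apply, inner_self_eq_norm_sq_to_K]
      norm_cast
  rw [← h.tsum_eq, ENNReal.ofReal_tsum_of_nonneg (fun i => by positivity) h.summable]

/-- The trace of a projection `Q` is at least the number of elements of any orthonormal family
in its range: with `‖Q b‖² ≥ ∑ k, |⟪Q b, f k⟫|² = ∑ k, |⟪b, f k⟫|²`, sum over `b` first. -/
theorem hilbertTrace_eq_top {Q : H →L[ℂ] H} (hQQ : ∀ x, Q (Q x) = Q x)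
    (hQ : ∀ x y, ⟪x, Q y⟫_ℂ = ⟪Q x, y⟫_ℂ) {M : Submodule ℂ H} (hM : ¬ FiniteDimensional ℂ M)
    (hQM : ∀ x ∈ M, Q x = x) {ι : Type*} (b : HilbertBasis ι ℂ H) : hilbertTrace b Q = ⊤ := by
  refine ENNReal.eq_top_of_forall_nnreal_le fun r => ?_
  obtain ⟨n, hn⟩ := exists_nat_ge r
  refine le_trans (by exact_mod_cast hn) (?_ : (n : ℝ≥0∞) ≤ _)
  obtain ⟨f, hf, hfM⟩ := exists_orthonormal_of_not_finiteDimensional hM n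
  have h1 : (n : ℝ≥0∞) = ∑ k, ∑' i, ENNReal.ofReal (‖⟪b i, f k⟫_ℂ‖ ^ 2) := by
    simp only [tsum_ofReal_norm_inner_sq, hf.1]
    simp
  rw [h1, ← Summable.tsum_finsetSum fun k _ => ENNReal.summable]
  refine ENNReal.tsum_le_tsum fun i => ?_
  rw [← ENNReal.ofReal_sum_of_nonneg fun k _ => by positivity]
  refine ENNReal.ofReal_le_ofReal ?_
  have h2 : RCLike.re ⟪b i, Q (b i)⟫_ℂ = ‖Q (b i)‖ ^ 2 := by
    rw [← hQQ (b i), hQ, hQQ, inner_self_eq_norm_sq]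
  rw [h2]
  refine le_trans (Finset.sum_le_sum fun k _ => ?_)
    (hf.sum_inner_products_le (Q (b i)) (s := Finset.univ))
  rw [hQ, hQM _ (hfM k), norm_inner_symm]

/-- A family of isometries that tends weakly to zero has no nonzero finite-dimensional invariant
subspace, since on such a subspace it would tend to zero strongly. -/
theorem eq_bot_of_weakly_tendsto_zero {ι : Type*} {l : Filter ι} [l.NeBot] {L : ι → H →L[ℂ] H}
    (hL : ∀ i x, ‖L i x‖ = ‖x‖) (hw : ∀ x y, Tendsto (fun i => ⟪y, L i x⟫_ℂ) l (𝓝 0))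
    {M : Submodule ℂ H} [FiniteDimensional ℂ M] (hM : ∀ i, ∀ x ∈ M, L i x ∈ M) : M = ⊥ := by
  rw [Submodule.eq_bot_iff]
  intro x hx
  let e := stdOrthonormalBasis ℂ M
  have h1 : ∀ i, ∑ k, ‖⟪(e k : H), L i x⟫_ℂ‖ ^ 2 = ‖x‖ ^ 2 := fun i => by
    rw [← hL i x]
    exact e.sum_sq_norm_inner_right (⟨L i x, hM i x hx⟩ : M)
  have h2 : Tendsto (fun i => ∑ k, ‖⟪(e k : H), L i x⟫_ℂ‖ ^ 2) l (𝓝 (∑ k, ‖(0 : ℂ)‖ ^ 2)) :=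
    tendsto_finsetSum _ fun k _ => ((hw x (e k)).norm).pow 2
  simp only [h1] at h2
  have h3 := tendsto_nhds_unique h2 tendsto_const_nhds
  simpa using h3.symm

end HilbertTrace

/-! ### The Hilbert space `H_τ` -/

section GNS

variable {A E : Type*} [CStarAlgebra A] [PartialOrder A] [StarOrderedRing A]
  [NormedAddCommGroup E] [NormedSpace ℂ E] [Module A E] [CStarModule A E]
  {τ : A →ₚ[ℂ] ℂ}

theorem inner_toGNS (x y : E) : ⟪toGNS τ E x, toGNS τ E y⟫_ℂ = τ ⟪x, y⟫_A :=
  UniformSpace.Completion.inner_coe (toPreGNS τ E x) (toPreGNS τ E y)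

theorem norm_toGNS_sq (x : E) : ‖toGNS τ E x‖ ^ 2 = (τ ⟪x, x⟫_A).re := by
  rw [← inner_toGNS, ← inner_self_eq_norm_sq (𝕜 := ℂ)]
  rfl

theorem denseRange_toGNS : DenseRange (toGNS τ E) :=
  UniformSpace.Completion.denseRange_coe (α := PreGNS τ E)

theorem continuous_toGNS : Continuous (toGNS τ E) := by
  obtain ⟨C, hC⟩ := PositiveLinearMap.exists_norm_apply_le τ
  refine AddMonoidHomClass.continuous_of_bound (toGNS τ E) (√C) fun x => ?_
  refine le_of_sq_le_sq ?_ (by positivity)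
  rw [norm_toGNS_sq, mul_pow, Real.sq_sqrt C.coe_nonneg, CStarModule.norm_sq_eq A]
  exact (Complex.re_le_norm _).trans (hC _)

theorem IsFaithfulTrace.eq_zero_of_nonneg (hτ : IsFaithfulTrace τ) {a : A} (ha : 0 ≤ a)
    (h : τ a = 0) : a = 0 := by
  obtain ⟨b, rfl⟩ := CStarAlgebra.nonneg_iff_eq_star_mul_self.1 ha
  rw [hτ.faithful b h, mul_zero]

theorem toGNS_injective (hτ : IsFaithfulTrace τ) : Function.Injective (toGNS τ E) := by
  refine (injective_iff_map_eq_zero _).2 fun x hx => ?_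
  refine CStarModule.inner_self.1 (hτ.eq_zero_of_nonneg CStarModule.inner_self_nonneg ?_)
  rw [← inner_toGNS, hx, inner_zero_left]

theorem exists_gnsExtension (T : E →ₗ[ℂ] E) (C : ℝ)
    (hT : ∀ x, ‖toGNS τ E (T x)‖ ≤ C * ‖toGNS τ E x‖) :
    ∃ Q : GNS τ E →L[ℂ] GNS τ E, ∀ x, Q (toGNS τ E x) = toGNS τ E (T x) := by
  let T₀ : PreGNS τ E →L[ℂ] PreGNS τ E :=
    LinearMap.mkContinuous ((toPreGNS τ E).toLinearMap ∘ₗ T ∘ₗ (toPreGNS τ E).symm.toLinearMap) C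
      fun x => by
        have := hT ((toPreGNS τ E).symm x)
        exact (UniformSpace.Completion.norm_coe _).symm.trans_le
          (this.trans_eq (congrArg (C * ·) (UniformSpace.Completion.norm_coe _)))
  exact ⟨T₀.completion, fun x => ContinuousLinearMap.completion_apply_coe T₀ (toPreGNS τ E x)⟩

/-- A unitary of `A` acts isometrically on `H_τ`, because `τ` is a trace:
`τ ⟪u x, u x⟫ = τ (u ⟪x, x⟫ u*) = τ ⟪x, x⟫`. -/
theorem exists_unitary_gnsExtension [IsScalarTower ℂ A E] (hτ : IsFaithfulTrace τ) {u : A}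
    (hu : u ∈ unitary A) :
    ∃ L : GNS τ E →L[ℂ] GNS τ E, (∀ x, L (toGNS τ E x) = toGNS τ E (u • x)) ∧
      ∀ ξ, ‖L ξ‖ = ‖ξ‖ := by
  have hiso : ∀ x : E, ‖toGNS τ E (u • x)‖ = ‖toGNS τ E x‖ := fun x => by
    rw [← sq_eq_sq₀ (norm_nonneg _) (norm_nonneg _), norm_toGNS_sq, norm_toGNS_sq,
      CStarModule.inner_op_smul_right, CStarModule.inner_op_smul_left, hτ.trace, mul_assoc,
      (Unitary.mem_iff.1 hu).1, mul_one]
  let T : E →ₗ[ℂ] E :=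
    { toFun := fun x => u • x
      map_add' := smul_add u
      map_smul' := fun c x => smul_comm u c x }
  obtain ⟨L, hL⟩ := exists_gnsExtension (τ := τ) T 1 fun x => by rw [one_mul]; exact (hiso x).le
  refine ⟨L, hL, fun ξ => ?_⟩
  refine denseRange_toGNS.induction_on ξ (isClosed_eq (by fun_prop) (by fun_prop)) fun x => ?_
  rw [hL]
  exact hiso x

/-- For orthonormal unitaries `u` of `A`, `⟨y | u x⟩_τ = τ (⟪y, x⟫ u)` is a coefficient of
`⟪x, y⟫` in `h_τ`, so that it tends to zero by Bessel's inequality. -/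
theorem tendsto_inner_unitary_smul (hτ : IsFaithfulTrace τ) {s : Set A}
    (b : HilbertBasis s ℂ τ.GNS)
    (hb : ∀ u : s, b u = ((τ.toPreGNS (u : A) : τ.PreGNS) : τ.GNS)) (x y : E) :
    Tendsto (fun u : s => ⟪toGNS τ E y, toGNS τ E ((u : A) • x)⟫_ℂ) cofinite (𝓝 0) := by
  have h1 := (b.orthonormal.inner_products_summable
    ((τ.toPreGNS ⟪x, y⟫_A : τ.PreGNS) : τ.GNS)).tendsto_cofinite_zero
  rw [tendsto_zero_iff_norm_tendsto_zero]
  have h2 := (Real.continuous_sqrt.tendsto 0).comp h1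
  rw [Real.sqrt_zero] at h2
  refine h2.congr fun u => ?_
  rw [Function.comp_apply, Real.sqrt_sq (norm_nonneg _), norm_inner_symm, hb,
    UniformSpace.Completion.inner_coe, τ.preGNS_inner_def, inner_toGNS]
  simp only [PositiveLinearMap.ofPreGNS_toPreGNS, CStarModule.star_inner,
    CStarModule.inner_op_smul_right]
  rw [hτ.trace]

/-- Weak convergence passes from the dense subspace `E` to all of `H_τ` because the operators are
uniformly bounded. -/
theorem tendsto_inner_unitary (hτ : IsFaithfulTrace τ) {s : Set A}
    (b : HilbertBasis s ℂ τ.GNS)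
    (hb : ∀ u : s, b u = ((τ.toPreGNS (u : A) : τ.PreGNS) : τ.GNS))
    {L : s → GNS τ E →L[ℂ] GNS τ E}
    (hL : ∀ (u : s) x, L u (toGNS τ E x) = toGNS τ E ((u : A) • x))
    (hnorm : ∀ (u : s) ξ, ‖L u ξ‖ = ‖ξ‖) (ξ η : GNS τ E) :
    Tendsto (fun u => ⟪η, L u ξ⟫_ℂ) cofinite (𝓝 0) := by
  rw [Metric.tendsto_nhds]
  intro ε hε
  obtain ⟨δ, hδ, hδε⟩ : ∃ δ : ℝ, 0 < δ ∧ δ * (‖ξ‖ + δ) + ‖η‖ * δ < ε := by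
    have hc : Continuous fun δ : ℝ => δ * (‖ξ‖ + δ) + ‖η‖ * δ := by fun_prop
    have h1 : ∀ᶠ δ in 𝓝 (0 : ℝ), δ * (‖ξ‖ + δ) + ‖η‖ * δ < ε :=
      hc.continuousAt.eventually_lt continuousAt_const (by simpa using hε)
    obtain ⟨δ, h2, h3⟩ := ((h1.filter_mono nhdsWithin_le_nhds).and
      (self_mem_nhdsWithin : Set.Ioi (0 : ℝ) ∈ 𝓝[>] 0)).exists
    exact ⟨δ, h3, h2⟩
  obtain ⟨x, hx⟩ := denseRange_toGNS.exists_dist_lt ξ hδ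
  obtain ⟨y, hy⟩ := denseRange_toGNS.exists_dist_lt η hδ
  rw [dist_eq_norm] at hx hy
  have hxn : ‖toGNS τ E x‖ ≤ ‖ξ‖ + δ := by
    have := norm_sub_norm_le (toGNS τ E x) ξ
    rw [norm_sub_rev] at this
    linarith
  have h2 := (Metric.tendsto_nhds.1 (tendsto_inner_unitary_smul hτ b hb x y))
    (ε - (δ * (‖ξ‖ + δ) + ‖η‖ * δ)) (by linarith)
  filter_upwards [h2] with u hu
  rw [dist_zero_right] at hu ⊢
  have h3 : ⟪η, L u ξ⟫_ℂ = ⟪η, L u (ξ - toGNS τ E x)⟫_ℂ + ⟪η - toGNS τ E y, L u (toGNS τ E x)⟫_ℂ +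
      ⟪toGNS τ E y, toGNS τ E ((u : A) • x)⟫_ℂ := by
    rw [← hL, map_sub, inner_sub_right, inner_sub_left]
    ring
  have h4 : ‖⟪η, L u (ξ - toGNS τ E x)⟫_ℂ‖ ≤ ‖η‖ * δ :=
    (norm_inner_le_norm _ _).trans (by rw [hnorm]; gcongr)
  have h5 : ‖⟪η - toGNS τ E y, L u (toGNS τ E x)⟫_ℂ‖ ≤ δ * (‖ξ‖ + δ) :=
    (norm_inner_le_norm _ _).trans (by rw [hnorm]; gcongr)
  rw [h3]
  refine (norm_add₃_le).trans_lt ?_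
  linarith

/-- The algebra `A` embeds into `h_τ`, which therefore has no finite orthonormal basis. -/
theorem infinite_of_unitaryBasis (hτ : IsFaithfulTrace τ) (hA : ¬ FiniteDimensional ℂ A)
    {s : Set A} (b : HilbertBasis s ℂ τ.GNS) : Infinite s := by
  by_contra h
  rw [not_infinite_iff_finite] at h
  have := Fintype.ofFinite s
  have : FiniteDimensional ℂ τ.GNS := b.toOrthonormalBasis.toBasis.finiteDimensional_of_finite
  let j : A →ₗ[ℂ] τ.GNS :=
    (UniformSpace.Completion.toComplL (𝕜 := ℂ) (E := τ.PreGNS)).toLinearMap ∘ₗ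
      τ.toPreGNS.toLinearMap
  have hj : ∀ a c, ⟪j a, j c⟫_ℂ = τ (star a * c) := fun a c =>
    UniformSpace.Completion.inner_coe (τ.toPreGNS a) (τ.toPreGNS c)
  refine hA (FiniteDimensional.of_injective j ((injective_iff_map_eq_zero _).2 fun a ha => ?_))
  exact hτ.faithful a (by rw [← hj, ha, inner_zero_left])

/-- If `h_τ` has an orthonormal basis of unitaries and `A` is infinite dimensional, a nonzero
subspace of `H_τ` that is invariant under the unitaries of `A` is infinite dimensional. -/
theorem eq_bot_of_unitary_invariant [IsScalarTower ℂ A E] (hτ : IsFaithfulTrace τ)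
    (hA : ¬ FiniteDimensional ℂ A) (hU : HasUnitaryBasis τ) {M : Submodule ℂ (GNS τ E)}
    (hM : ∀ u ∈ unitary A, ∀ L : GNS τ E →L[ℂ] GNS τ E,
      (∀ x, L (toGNS τ E x) = toGNS τ E (u • x)) → ∀ ξ ∈ M, L ξ ∈ M)
    (hfin : FiniteDimensional ℂ M) : M = ⊥ := by
  obtain ⟨s, hs, b, hb⟩ := hU
  have := infinite_of_unitaryBasis hτ hA b
  choose L hL hnorm using fun u : s => exists_unitary_gnsExtension (E := E) hτ (hs u.2)
  exact eq_bot_of_weakly_tendsto_zero hnorm (fun ξ η => tendsto_inner_unitary hτ b hb hL hnorm ξ η)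
    fun u ξ hξ => hM u (hs u.2) (L u) (hL u) ξ hξ

variable [IsScalarTower ℂ A E]

theorem toGNS_mem_closureInGNS {N : Submodule A E} {x : E} (hx : x ∈ N) :
    toGNS τ E x ∈ closureInGNS τ N :=
  Submodule.le_topologicalClosure _ ⟨x, hx, rfl⟩

/-- As `τ` is faithful, `E` embeds into `H_τ`, so that the closure of `N` is nonzero. -/
theorem not_finiteDimensional_closureInGNS (hτ : IsFaithfulTrace τ)
    (hA : ¬ FiniteDimensional ℂ A) (hU : HasUnitaryBasis τ) {N : Submodule A E} (hN : N ≠ ⊥) :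
    ¬ FiniteDimensional ℂ (closureInGNS τ N) := by
  intro hfin
  have h := eq_bot_of_unitary_invariant hτ hA hU (M := closureInGNS τ N) ?_ hfin
  · refine hN ((Submodule.eq_bot_iff _).2 fun x hx => ?_)
    have hx' := toGNS_mem_closureInGNS (τ := τ) hx
    rw [h, Submodule.mem_bot] at hx'
    exact toGNS_injective hτ (hx'.trans (map_zero _).symm)
  · intro u _ L hL ξ hξ
    refine map_mem_closure L.continuous hξ ?_
    rintro _ ⟨x, hx, rfl⟩
    exact ⟨u • x, N.smul_mem u hx, (hL x).symm⟩

/-- The orthogonal projection of `H_τ` onto the closure of `N`. -/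
theorem IsProjectionOnto.exists_gnsExtension {P : E →L[ℂ] E} {N : Submodule A E}
    (hP : IsProjectionOnto A P N) : ∃ Q : GNS τ E →L[ℂ] GNS τ E, IsGNSExtension τ P Q ∧
      (∀ ξ, Q (Q ξ) = Q ξ) ∧ (∀ ξ η, ⟪ξ, Q η⟫_ℂ = ⟪Q ξ, η⟫_ℂ) ∧
      ∀ ξ ∈ closureInGNS τ N, Q ξ = ξ := by
  have hbound : ∀ x, ‖toGNS τ E (P x)‖ ≤ 1 * ‖toGNS τ E x‖ := fun x => by
    have h1 : ‖toGNS τ E (P x)‖ * ‖toGNS τ E (P x)‖ ≤ ‖toGNS τ E x‖ * ‖toGNS τ E (P x)‖ := by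
      rw [← sq, ← inner_self_eq_norm_sq (𝕜 := ℂ), inner_toGNS, ← hP.symm, hP.idem, ← inner_toGNS]
      exact (RCLike.re_le_norm _).trans (norm_inner_le_norm _ _)
    rw [one_mul]
    rcases (norm_nonneg (toGNS τ E (P x))).eq_or_lt with h0 | h0
    · rw [← h0]; exact norm_nonneg _
    · exact le_of_mul_le_mul_right h1 h0
  obtain ⟨Q, hQ⟩ := NCBloch.exists_gnsExtension (τ := τ) (P : E →ₗ[ℂ] E) 1 hbound
  replace hQ : ∀ x, Q (toGNS τ E x) = toGNS τ E (P x) := hQ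
  refine ⟨Q, hQ, fun ξ => ?_, fun ξ η => ?_, fun ξ hξ => ?_⟩
  · refine denseRange_toGNS.induction_on ξ (isClosed_eq (by fun_prop) (by fun_prop)) fun x => ?_
    rw [hQ, hQ, hP.idem]
  · refine denseRange_toGNS.induction_on₂ (isClosed_eq (by fun_prop) (by fun_prop))
      (fun x y => ?_) ξ η
    rw [hQ, hQ, inner_toGNS, inner_toGNS, hP.symm]
  · refine closure_minimal (t := {ξ | Q ξ = ξ}) ?_ (isClosed_eq (by fun_prop) (by fun_prop)) hξ
    rintro _ ⟨x, hx, rfl⟩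
    exact (hQ x).trans (congrArg _ (hP.mem_iff.1 hx))

/-! ### The operator `D_τ` -/

/-- `D` is symmetric and densely defined in `H_τ`, hence closable. -/
theorem graph_hilbertOperator {D : E →ₗ.[A] E} (hD : IsSelfAdjointOp D) :
    (hilbertOperator τ D).graph = ((D.graph.restrictScalars ℂ).map
      ((toGNS τ E).prodMap (toGNS τ E))).topologicalClosure := by
  refine Submodule.toLinearPMap_graph_eq _ ?_
  rintro ⟨ξ, η⟩ hp (rfl : ξ = 0)
  have key : ∀ p ∈ ((D.graph.restrictScalars ℂ).map
      ((toGNS τ E).prodMap (toGNS τ E))).topologicalClosure, ∀ x y : E, (x, y) ∈ D.graph →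
      ⟪p.1, toGNS τ E y⟫_ℂ = ⟪p.2, toGNS τ E x⟫_ℂ := by
    intro p hp x y hxy
    refine closure_minimal (t := {p | ⟪p.1, toGNS τ E y⟫_ℂ = ⟪p.2, toGNS τ E x⟫_ℂ}) ?_
      (isClosed_eq (by fun_prop) (by fun_prop)) hp
    rintro _ ⟨⟨x', y'⟩, h, rfl⟩
    simp only [Set.mem_ofPred_eq, LinearMap.prodMap_apply, inner_toGNS]
    rw [hD.inner_comm h hxy]
  refine Dense.eq_zero_of_inner_left ℂ (denseRange_toGNS.dense_image continuous_toGNS hD.1) ?_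
  rintro _ ⟨x, hx, rfl⟩
  have h1 := key _ hp x (D ⟨x, hx⟩) (D.mem_graph ⟨x, hx⟩)
  rw [← h1, inner_zero_left]

/-- No eigenvalue of `D_τ` has finite multiplicity: the graph of `D_τ`, and with it each eigenspace,
is invariant under the unitaries of `A`. -/
theorem essentialSpectrum_hilbertOperator (hτ : IsFaithfulTrace τ)
    (hA : ¬ FiniteDimensional ℂ A) (hU : HasUnitaryBasis τ) {D : E →ₗ.[A] E}
    (hD : IsSelfAdjointOp D) :
    essentialSpectrum (hilbertOperator τ D) = hilbertSpectrum (hilbertOperator τ D) := by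
  refine sdiff_eq_left.2 (Set.disjoint_right.2 ?_)
  rintro z ⟨_, _, hne, hfin⟩ _
  refine hne (eq_bot_of_unitary_invariant hτ hA hU (fun u _ L hL ξ hξ => ?_) hfin)
  change (ξ, z • ξ) ∈ (hilbertOperator τ D).graph at hξ
  change (L ξ, z • L ξ) ∈ (hilbertOperator τ D).graph
  rw [graph_hilbertOperator hD] at hξ ⊢
  rw [← _root_.map_smul]
  refine map_mem_closure (f := Prod.map L L) (L.continuous.prodMap L.continuous) hξ ?_
  rintro _ ⟨⟨x, y⟩, h, rfl⟩
  refine ⟨(u • x, u • y), D.graph.smul_mem u h, ?_⟩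
  simp [hL]

end GNS

end NCBloch

theorem mainTheorem2 {A E : Type*} [CStarAlgebra A] [PartialOrder A] [StarOrderedRing A]
    [NormedAddCommGroup E] [NormedSpace ℂ E] [CompleteSpace E] [Module A E] [CStarModule A E]
    [IsScalarTower ℂ A E] (D : E →ₗ.[A] E) (hD : IsElliptic D) (hDsa : IsSelfAdjointOp D) :
    -- the eigenspace is finitely generated projective and the eigenprojection is `A`-finite
    (∀ l : ℝ, IsIsolatedEigenvalue D l →
      IsClosed (eigenspace D l : Set E) ∧
      Module.Finite A (eigenspace D l) ∧ Module.Projective A (eigenspace D l) ∧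
      ∃ P ∈ finiteOperators A E, IsProjectionOnto A P (eigenspace D l)) ∧
    ∀ τ : A →ₚ[ℂ] ℂ, IsFaithfulTrace τ →
      -- finite `τ`-dimension
      (∀ t > 0, ∀ U : E →L[ℂ] E, IsHeatOperator D t U → U ∈ traceClass τ →
        ∀ l : ℝ, IsIsolatedEigenvalue D l →
          ∀ P : E →L[ℂ] E, IsProjectionOnto A P (eigenspace D l) →
            P ∈ traceClass τ ∧ trTau τ P ≠ ⊤ ∧
            ∀ (n : ℕ) (x y : Fin n → E), P = ∑ i, rankOne A (x i) (y i) →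
              ∑ i, τ (inner A (y i) (x i)) = ((trTau τ P).toReal : ℂ)) ∧
      -- infinite multiplicity
      (¬ FiniteDimensional ℂ A → HasUnitaryBasis τ →
        (∀ l : ℝ, IsIsolatedEigenvalue D l →
          ¬ FiniteDimensional ℂ (closureInGNS τ (eigenspace D l)) ∧
          ∀ P : E →L[ℂ] E, IsProjectionOnto A P (eigenspace D l) →
            ∃ Q : GNS τ E →L[ℂ] GNS τ E, IsGNSExtension τ P Q ∧
              ∀ (s : Set (GNS τ E)) (b : HilbertBasis s ℂ (GNS τ E)), hilbertTrace b Q = ⊤) ∧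
        essentialSpectrum (hilbertOperator τ D) = hilbertSpectrum (hilbertOperator τ D)) := by
  refine ⟨fun l hl => ?_, fun τ hτ => ⟨?_, fun hA hU => ⟨fun l hl => ?_, ?_⟩⟩⟩
  · obtain ⟨P, hP⟩ := exists_eigenprojection hDsa hl.2
    have hF := hD.eigenprojection_mem_finiteOperators hDsa hP
    obtain ⟨h1, h2⟩ := hP.finite_and_projective hF
    exact ⟨hP.isClosed, h1, h2, P, hF, hP⟩
  · intro t _ U _ _ l _ P hP
    exact hP.mem_traceClass hτ (hD.eigenprojection_mem_finiteOperators hDsa hP)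
  · have hinf := not_finiteDimensional_closureInGNS hτ hA hU hl.1
    refine ⟨hinf, fun P hP => ?_⟩
    obtain ⟨Q, hPQ, hQQ, hQ, hQM⟩ := hP.exists_gnsExtension (τ := τ)
    exact ⟨Q, hPQ, fun s b => hilbertTrace_eq_top hQQ hQ hinf hQM b⟩
  · exact essentialSpectrum_hilbertOperator hτ hA hU hDsa
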